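/- Let $G=(V,E)$ be a finite simple graph. A perfect $m$-coloring of $G$ with color adjacency matrix $A=(a_{ij})\in\mathbb N^{m\times m}$ is a surjective map $V\to\{1,\dots,m\}$ such that every vertex of color $i$ has exactly $a_{ij}$ neighbors of color $j$, for all $i,j$ (adjacent vertices may have the same color). Two matrices are equivalent if they are conjugate by a permutation matrix, that is, if they differ by a permutation of the colors. Let $G$ be one of the Platonic graphs (the edge graphs of the tetrahedron, cube, octahedron, dodecahedron and icosahedron), let $n$ be its number of vertices and $k$ its degree. Call $A\in\mathbb N^{m\times m}$ a candidate for $G$ if 1. all row sums of $A$ equal $k$; 2. $a_{ij}=0$ if and only if $a_{ji}=0$, for all $i,j$; 3. $a_{n_1n_2}a_{n_2n_3}\cdots a_{n_tn_1}=a_{n_2n_1}a_{n_3n_2}\cdots a_{n_1n_t}$ for each nontrivial cycle $(n_1\,n_2\,\dots\,n_t)$ of the symmetric group $S_m$; 4. $A$ is irreducible: it is not conjugate by a permutation matrix to a block diagonal matrix with more than one block; 5. there are positive integers $v_1,\dots,v_m$ with sum $n$ such that $v_ia_{ij}=v_ja_{ji}$ for all $i,j$ (the sizes of the color classes); 6.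 every eigenvalue of $A$ is an eigenvalue of the adjacency matrix of $G$. Then, for $m\in\{2,3,4\}$, the candidates for the Platonic graphs are, up to equivalence and without repetition, exactly the following matrices. 2 colors: - Tetrahedron: $\begin{pmatrix}0&3\\1&2\end{pmatrix}, \begin{pmatrix}1&2\\2&1\end{pmatrix}$ - Cube: $\begin{pmatrix}0&3\\1&2\end{pmatrix}, \begin{pmatrix}0&3\\3&0\end{pmatrix}, \begin{pmatrix}1&2\\2&1\end{pmatrix}, \begin{pmatrix}2&1\\1&2\end{pmatrix}$ - Octahedron: $\begin{pmatrix}0&4\\2&2\end{pmatrix}, \begin{pmatrix}1&3\\3&1\end{pmatrix}^{\dagger}, \begin{pmatrix}2&2\\2&2\end{pmatrix}$ - Dodecahedron: $\begin{pmatrix}0&3\\2&1\end{pmatrix}, \begin{pmatrix}2&1\\1&2\end{pmatrix}$ - Icosahedron: $\begin{pmatrix}0&5\\1&4\end{pmatrix}, \begin{pmatrix}1&4\\2&3\end{pmatrix}, \begin{pmatrix}2&3\\3&2\end{pmatrix}$ 3 colors: - Tetrahedron: $\begin{pmatrix}0&1&2\\1&0&2\\1&1&1\end{pmatrix}$ -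 Cube: $\begin{pmatrix}0&1&2\\1&0&2\\1&1&1\end{pmatrix}, \begin{pmatrix}1&0&2\\0&1&2\\1&1&1\end{pmatrix}$ - Octahedron: $\begin{pmatrix}0&0&4\\0&0&4\\1&1&2\end{pmatrix}, \begin{pmatrix}0&2&2\\2&0&2\\2&2&0\end{pmatrix}, \begin{pmatrix}0&2&2\\2&1&1\\2&1&1\end{pmatrix}$ - Dodecahedron: $\begin{pmatrix}0&0&3\\0&0&3\\1&1&1\end{pmatrix}, \begin{pmatrix}0&3&0\\1&0&2\\0&1&2\end{pmatrix}, \begin{pmatrix}1&0&2\\0&1&2\\1&2&0\end{pmatrix}$ - Icosahedron: $\begin{pmatrix}0&1&4\\1&0&4\\1&1&3\end{pmatrix}, \begin{pmatrix}0&2&3\\1&1&3\\1&2&2\end{pmatrix}, \begin{pmatrix}1&2&2\\2&1&2\\2&2&1\end{pmatrix}$ 4 colors: - Tetrahedron: $\begin{pmatrix}0&1&1&1\\1&0&1&1\\1&1&0&1\\1&1&1&0\end{pmatrix}$ - Cube: $\begin{pmatrix}0&0&0&3\\0&0&3&0\\0&1&0&2\\1&0&2&0\end{pmatrix}, \begin{pmatrix}0&0&1&2\\0&0&2&1\\1&2&0&0\\2&1&0&0\end{pmatrix},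 \begin{pmatrix}0&1&1&1\\1&0&1&1\\1&1&0&1\\1&1&1&0\end{pmatrix}, \begin{pmatrix}0&1&1&1\\1&0&1&1\\1&1&1&0\\1&1&0&1\end{pmatrix}, \begin{pmatrix}1&0&1&1\\0&1&1&1\\1&1&1&0\\1&1&0&1\end{pmatrix}$ - Octahedron: $\begin{pmatrix}0&0&2&2\\0&0&2&2\\1&1&0&2\\1&1&2&0\end{pmatrix}, \begin{pmatrix}0&0&2&2\\0&0&2&2\\1&1&1&1\\1&1&1&1\end{pmatrix}$ - Dodecahedron: $\begin{pmatrix}0&0&0&3\\0&0&2&1\\0&2&0&1\\1&1&1&0\end{pmatrix}, \begin{pmatrix}0&0&0&3\\0&1&1&1\\0&1&1&1\\1&1&1&0\end{pmatrix}, \begin{pmatrix}0&0&1&2\\0&0&1&2\\1&1&1&0\\1&1&0&1\end{pmatrix}, \begin{pmatrix}0&0&1&2\\0&2&0&1\\1&0&2&0\\2&1&0&0\end{pmatrix}, \begin{pmatrix}1&0&0&2\\0&1&0&2\\0&0&1&2\\1&1&1&0\end{pmatrix}$ - Icosahedron: $\begin{pmatrix}0&0&0&5\\0&0&5&0\\0&1&2&2\\1&0&2&2\end{pmatrix},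 \begin{pmatrix}0&1&1&3\\1&0&1&3\\1&1&0&3\\1&1&1&2\end{pmatrix}, \begin{pmatrix}0&1&2&2\\1&0&2&2\\1&1&1&2\\1&1&2&1\end{pmatrix}, \begin{pmatrix}0&1&2&2\\1&2&0&2\\2&0&2&1\\2&2&1&0\end{pmatrix}$ The characteristic polynomial of every candidate divides the characteristic polynomial of the adjacency matrix of the graph. Every candidate is the color adjacency matrix of a perfect coloring of the graph, except for the matrix marked $\dagger$ of the octahedron (and its equivalents), which is not the color adjacency matrix of any perfect coloring of the octahedron. Conversely, the color adjacency matrix of every perfect $2$-, $3$- or $4$-coloring of a Platonic graph is equivalent to exactly one of the matrices listed for that graph and that number of colors, other than $\dagger$. -/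

import Mathlib

/-! ### Perfect colorings -/

/-- `f` is a perfect coloring of `G` with `m` colors and color adjacency matrix `A`: all colors are
used, and every vertex of color `i` has exactly `A i j` neighbors of color `j`. -/
def IsPerfectColoring {V : Type} [Fintype V] (G : SimpleGraph V) [DecidableRel G.Adj] {m : ℕ}
    (f : V → Fin m) (A : Matrix (Fin m) (Fin m) ℕ) : Prop :=
  Function.Surjective f ∧
    ∀ (v : V) (j : Fin m), (Finset.univ.filter fun w => G.Adj v w ∧ f w = j).card = A (f v) j

/-- The set of all color adjacency matrices of perfect `m`-colorings of `G`. -/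
def colorAdjacencyMatrices {V : Type} [Fintype V] (G : SimpleGraph V) [DecidableRel G.Adj]
    (m : ℕ) : Set (Matrix (Fin m) (Fin m) ℕ) :=
  {A | ∃ f : V → Fin m, IsPerfectColoring G f A}

/-! ### Candidates -/

/-- Weak symmetry: `A i j = 0` if and only if `A j i = 0`. -/
def WeaklySymmetric {m : ℕ} (A : Matrix (Fin m) (Fin m) ℕ) : Prop :=
  ∀ i j, A i j = 0 ↔ A j i = 0

/-- Consistency: along each nontrivial cycle `c` of the symmetric group, the product of the entries
`A i (c i)` equals the product of the entries `A (c i) i`. -/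
def Consistent {m : ℕ} (A : Matrix (Fin m) (Fin m) ℕ) : Prop :=
  ∀ c : Equiv.Perm (Fin m), c.IsCycle →
    ∏ i ∈ c.support, A i (c i) = ∏ i ∈ c.support, A (c i) i

/-- Simultaneous permutation of rows and columns does not bring `A` into block diagonal form
with more than one block. -/
def BlockIrreducible {m : ℕ} (A : Matrix (Fin m) (Fin m) ℕ) : Prop :=
  ¬ ∃ S : Set (Fin m), S.Nonempty ∧ Sᶜ.Nonempty ∧
    ∀ i ∈ S, ∀ j ∈ Sᶜ, A i j = 0 ∧ A j i = 0

/-- The sizes `v i` of the color classes that `A` dictates on `n` vertices are positive integers.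
(They are determined by the double counting `v i * A i j = v j * A j i` of the edges between
two classes and by their sum `n`, as soon as `A` is irreducible.) -/
def HasIntegralClassSizes {m : ℕ} (A : Matrix (Fin m) (Fin m) ℕ) (n : ℕ) : Prop :=
  ∃ v : Fin m → ℕ, (∀ i, 0 < v i) ∧ (∀ i j, v i * A i j = v j * A j i) ∧ ∑ i, v i = n

/-- The candidates for color adjacency matrices of perfect `m`-colorings of the connected regular
graph `G`: matrices with row sums the degree of `G` that satisfy the general conditions on color
adjacency matrices of connected graphs, give integral class sizes, and have only eigenvalues
of `G` as eigenvalues. -/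
structure IsCandidate {V : Type} [Fintype V] [DecidableEq V] (G : SimpleGraph V) [DecidableRel G.Adj] {m : ℕ}
    (A : Matrix (Fin m) (Fin m) ℕ) : Prop where
  row_sum : ∀ (i : Fin m) (v : V), ∑ j, A i j = G.degree v
  weaklySymmetric : WeaklySymmetric A
  consistent : Consistent A
  irreducible : BlockIrreducible A
  classSizes : HasIntegralClassSizes A (Fintype.card V)
  eigenvalues : spectrum ℂ (A.map (fun a : ℕ => (a : ℂ))) ⊆ spectrum ℂ
    (G.adjMatrix ℂ)

/-! ### Lists of matrices up to a permutation of the colors -/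

/-- `A` and `B` differ by a permutation of the colors. -/
def ColorEquivalent {m : ℕ} (A B : Matrix (Fin m) (Fin m) ℕ) : Prop :=
  ∃ σ : Equiv.Perm (Fin m), A = B.submatrix σ σ

/-- `L` lists the matrices of `S` up to permutations of the colors, without repetition: `S` consists
of the matrices that are equivalent to a member of `L`, and the members of `L` are pairwise
inequivalent. -/
def ListsUpToColors {m : ℕ} (L : List (Matrix (Fin m) (Fin m) ℕ))
    (S : Set (Matrix (Fin m) (Fin m) ℕ)) : Prop :=
  (∀ A, A ∈ S ↔ ∃ B ∈ L, ColorEquivalent A B) ∧ L.Pairwise fun A B => ¬ ColorEquivalent A B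

/-- `L` lists the candidates for `m`-colorings of `G`. Moreover the sharper spectral condition, that
the characteristic polynomial of the matrix divides that of the graph (that is, eigenvalues are
counted with multiplicities), excludes none of them. -/
def ListsCandidates {V : Type} [Fintype V] [DecidableEq V] (G : SimpleGraph V) [DecidableRel G.Adj]
    {m : ℕ} (L : List (Matrix (Fin m) (Fin m) ℕ)) : Prop :=
  ListsUpToColors L {A | IsCandidate G A} ∧
    ∀ A : Matrix (Fin m) (Fin m) ℕ, IsCandidate G A →
      (A.map (fun a : ℕ => (a : ℂ))).charpoly ∣ (G.adjMatrix ℂ).charpoly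

/-- `L` lists the candidates for `m`-colorings of `G`, and also the matrices that really occur. -/
def ListsCandidatesAllRealized {V : Type} [Fintype V] [DecidableEq V] (G : SimpleGraph V)
    [DecidableRel G.Adj] {m : ℕ} (L : List (Matrix (Fin m) (Fin m) ℕ)) : Prop :=
  ListsCandidates G L ∧ ListsUpToColors L (colorAdjacencyMatrices G m)

/-! ### The Platonic graphs -/

/-- The tetrahedral graph: the complete graph on four vertices. -/
abbrev tetrahedronGraph : SimpleGraph (Fin 4) := ⊤

/-- The cube graph: vertices are 0-1-vectors of length 3, adjacent when they differ in exactly one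
coordinate. -/
def cubeGraph : SimpleGraph (Fin 3 → Bool) where
  Adj x y := hammingDist x y = 1
  symm := ⟨fun x y h => by rw [hammingDist_comm]; exact h⟩
  loopless := ⟨fun x h => by simp at h⟩

instance : DecidableRel cubeGraph.Adj := fun x y => inferInstanceAs (Decidable (hammingDist x y = 1))

/-- The octahedral graph: `(i, false)` and `(i, true)` are the two opposite vertices on the `i`-th
axis, and vertices are adjacent when they are on different axes. -/
def octahedronGraph : SimpleGraph (Fin 3 × Bool) where
  Adj x y := x.1 ≠ y.1
  symm := ⟨fun _ _ h => Ne.symm h⟩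
  loopless := ⟨fun _ h => h rfl⟩

instance : DecidableRel octahedronGraph.Adj := fun x y => inferInstanceAs (Decidable (x.1 ≠ y.1))

/-- The edges of the dodecahedral graph, each in one direction. The graph is drawn as the generalized
Petersen graph `GP(10, 2)`: an outer cycle `(0, i)`, spokes from `(0, i)` to `(1, i)`, and inner
edges from `(1, i)` to `(1, i + 2)`; addition is modulo 10. -/
def dodecahedronRel (u v : Fin 2 × Fin 10) : Prop :=
  (u.1 = 0 ∧ v.1 = 0 ∧ v.2 = u.2 + 1) ∨
  (u.1 = 0 ∧ v.1 = 1 ∧ v.2 = u.2) ∨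
  (u.1 = 1 ∧ v.1 = 1 ∧ v.2 = u.2 + 2)

instance : DecidableRel dodecahedronRel := fun u v => by
  unfold dodecahedronRel; infer_instance

/-- The dodecahedral graph. -/
def dodecahedronGraph : SimpleGraph (Fin 2 × Fin 10) := SimpleGraph.fromRel dodecahedronRel

instance : DecidableRel dodecahedronGraph.Adj := fun u v =>
  inferInstanceAs (Decidable ((SimpleGraph.fromRel dodecahedronRel).Adj u v))

/-- The edges of the icosahedral graph, each in one direction. The two poles are `(0, none)` and
`(1, none)`; each pole `(s, none)` is joined to the five vertices `(s, some i)` of its pentagon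
`(s, some i), (s, some (i + 1))`; the two pentagons are joined as in an antiprism, `(0, some i)`
to `(1, some i)` and `(1, some (i + 1))`; addition is modulo 5. -/
def icosahedronRel : Fin 2 × Option (Fin 5) → Fin 2 × Option (Fin 5) → Prop
  | (s, none), (t, some _) => s = t
  | (s, some i), (t, some j) => (s = t ∧ j = i + 1) ∨ (s = 0 ∧ t = 1 ∧ (j = i ∨ j = i + 1))
  | (_, _), (_, none) => False

instance : DecidableRel icosahedronRel
  | (s, none), (t, some _) => inferInstanceAs (Decidable (s = t))
  | (s, some i), (t, some j) => inferInstanceAs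
      (Decidable ((s = t ∧ j = i + 1) ∨ (s = 0 ∧ t = 1 ∧ (j = i ∨ j = i + 1))))
  | (_, none), (_, none) => inferInstanceAs (Decidable False)
  | (_, some _), (_, none) => inferInstanceAs (Decidable False)

/-- The icosahedral graph. -/
def icosahedronGraph : SimpleGraph (Fin 2 × Option (Fin 5)) := SimpleGraph.fromRel icosahedronRel

instance : DecidableRel icosahedronGraph.Adj := fun u v =>
  inferInstanceAs (Decidable ((SimpleGraph.fromRel icosahedronRel).Adj u v))

/-! Two inclusions are needed: every candidate occurs in the list, and every listed matrix is a
candidate with the stated divisibility.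

For the second, a perfect coloring intertwines the adjacency matrix with its color matrix through
the class indicators, so characteristic polynomials divide
(`Matrix.charpoly_dvd_charpoly_of_intertwine`). Double counting gives class sizes, hence weak
symmetry and consistency, and connectedness gives irreducibility (`IsPerfectColoring.isCandidate`).
An explicit coloring therefore settles each listed matrix, except the unrealized octahedral one,
where a rational intertwiner replaces the coloring (`octahedron_charpoly_dvd`).

For the first, the class sizes bound the problem: they sum to `n`, and together with the entries
above the diagonal and the row sums they determine the matrix. The spectral condition becomes an
integer identity. A candidate is self-adjoint for the inner product weighted by class sizes, so if
`p` annihilates the graph, then `p(A)` is nilpotent and self-adjoint, hence zero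
(`IsCandidate.aeval_eq_zero`). Such a `p` need only annihilate the small quotient by distance from a
vertex (`IsDistancePartition.aeval_adjMatrix_eq_zero`). The kernel then searches all balanced
irreducible matrices with sorted classes; those passing one scalar consequence of `p(A) = 0` are all
in the list (`exists_colorEquivalent_of_holdsForSorted`). -/

open Polynomial Matrix

/-! ### Divisibility of characteristic polynomials under intertwining -/

/-- The idempotent `E = P * Q` projects onto an `M`-invariant summand on which `M` acts as `B`. Thus
`M` is block triangular with `B` as a diagonal block; working with `E` avoids choosing a basis, so
any commutative ring will do, in particular `R[X]`. -/
theorem Matrix.det_dvd_det_of_intertwine {R n m : Type*} [CommRing R] [Fintype n] [DecidableEq n]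
    [Fintype m] [DecidableEq m] {M : Matrix n n R} {B : Matrix m m R} {P : Matrix n m R}
    {Q : Matrix m n R} (hQ : Q * P = 1) (h : M * P = P * B) : B.det ∣ M.det := by
  have h1 : (1 - P * Q) * M * (P * Q) = 0 := by
    have : (1 - P * Q) * M * (P * Q) = (1 - P * Q) * (M * P) * Q := by
      simp only [Matrix.mul_assoc]
    rw [this, h]
    have : (1 - P * Q) * (P * B) * Q = (P - P * (Q * P)) * B * Q := by
      simp only [Matrix.mul_assoc, Matrix.sub_mul, Matrix.one_mul]
    rw [this, hQ, Matrix.mul_one, sub_self, Matrix.zero_mul, Matrix.zero_mul]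
  have h2 : (P * Q) * (P * Q) = P * Q := by
    rw [Matrix.mul_assoc, ← Matrix.mul_assoc Q, hQ, Matrix.one_mul]
  -- In blocks with respect to `E`: `[B, Y; 0, Z] = [1, 0; 0, Z] * [B, Y; 0, 1]`.
  have h3 : M = (P * Q + (1 - P * Q) * M) * (1 + P * (Q * (M - 1))) := by
    rw [← Matrix.mul_assoc P]
    generalize P * Q = E at h1 h2
    have e : (E + (1 - E) * M) * (1 + E * (M - 1))
        = E + (E * E) * M - E * E + (1 - E) * M + ((1 - E) * M * E) * (M - 1) := by
      noncomm_ring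
    rw [e, h1, h2]
    noncomm_ring
  -- By `det (1 + P * S) = det (1 + S * P)`, the determinant moves to the small side, where `Q * (M
  -- - 1) * P = B - 1`.
  have h4 : (1 + P * (Q * (M - 1))).det = B.det := by
    rw [Matrix.det_one_add_mul_comm, Matrix.mul_assoc, Matrix.sub_mul, h, Matrix.mul_sub,
      ← Matrix.mul_assoc, hQ, Matrix.one_mul, Matrix.one_mul, hQ]
    congr 1
    abel
  rw [h3, Matrix.det_mul, h4]
  exact dvd_mul_left _ _

theorem Matrix.charpoly_dvd_charpoly_of_intertwine {R n m : Type*} [CommRing R] [Fintype n]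
    [DecidableEq n] [Fintype m] [DecidableEq m] {M : Matrix n n R} {B : Matrix m m R}
    {P : Matrix n m R} {Q : Matrix m n R} (hQ : Q * P = 1) (h : M * P = P * B) :
    B.charpoly ∣ M.charpoly := by
  refine Matrix.det_dvd_det_of_intertwine (P := P.map C) (Q := Q.map C) ?_ ?_
  · rw [← Matrix.map_mul, hQ, Matrix.map_one _ (map_zero _) (map_one _)]
  · have h' := congrArg (fun Z : Matrix n m R => Z.map (C : R →+* R[X])) h
    simp only [Matrix.map_mul] at h'
    have e1 : (scalar n (X : R[X])) * P.map C = P.map C * scalar m (X : R[X]) := by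
      ext i j
      rw [scalar_apply, scalar_apply, Matrix.diagonal_mul, Matrix.mul_diagonal, mul_comm]
    simp only [charmatrix, Matrix.sub_mul, Matrix.mul_sub, RingHom.mapMatrix_apply, h', e1]

theorem spectrum_subset_of_charpoly_dvd {n m : Type*} [Fintype n] [DecidableEq n] [Fintype m]
    [DecidableEq m] {M : Matrix n n ℂ} {B : Matrix m m ℂ} (h : B.charpoly ∣ M.charpoly) :
    spectrum ℂ B ⊆ spectrum ℂ M := by
  intro r hr
  rw [Matrix.mem_spectrum_iff_isRoot_charpoly] at hr ⊢
  exact hr.dvd h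

/-! ### Perfect colorings are candidates -/

section

variable {V : Type} [Fintype V] [DecidableEq V] {G : SimpleGraph V} [DecidableRel G.Adj] {m : ℕ}

/-- The characteristic matrix of a coloring. -/
def colorIndicator {V : Type} {m : ℕ} (R : Type) [Zero R] [One R] (f : V → Fin m) :
    Matrix V (Fin m) R := Matrix.of fun v j => if f v = j then 1 else 0

omit [DecidableEq V] in
theorem adjMatrix_mul_colorIndicator {R : Type} [CommRing R] {f : V → Fin m}
    {A : Matrix (Fin m) (Fin m) ℕ}
    (h : ∀ (v : V) (j : Fin m), (Finset.univ.filter fun w => G.Adj v w ∧ f w = j).card = A (f v) j) :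
    G.adjMatrix R * colorIndicator R f = colorIndicator R f * A.map (fun a : ℕ => (a : R)) := by
  ext v j
  simp only [Matrix.mul_apply, colorIndicator, Matrix.of_apply, SimpleGraph.adjMatrix_apply,
    Matrix.map_apply, ite_mul, one_mul, zero_mul, Finset.sum_ite_eq, Finset.mem_univ, if_true,
    ← ite_and, ← h v j, Finset.card_filter]
  push_cast
  rfl

theorem IsPerfectColoring.charpoly_dvd {f : V → Fin m} {A : Matrix (Fin m) (Fin m) ℕ}
    (h : IsPerfectColoring G f A) :
    (A.map (fun a : ℕ => (a : ℂ))).charpoly ∣ (G.adjMatrix ℂ).charpoly := by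
  obtain ⟨s, hs⟩ := h.1.hasRightInverse
  refine Matrix.charpoly_dvd_charpoly_of_intertwine (P := colorIndicator ℂ f)
    -- One representative vertex per color gives a left inverse of the class indicators.
    (Q := Matrix.of fun j v => if v = s j then 1 else 0) ?_ (adjMatrix_mul_colorIndicator h.2)
  ext i j
  simp only [Matrix.mul_apply, colorIndicator, Matrix.of_apply, ite_mul, one_mul, zero_mul,
    Finset.sum_ite_eq', Finset.mem_univ, if_true, hs i, Matrix.one_apply]

omit [DecidableEq V] in
theorem IsPerfectColoring.hasIntegralClassSizes {f : V → Fin m} {A : Matrix (Fin m) (Fin m) ℕ}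
    (h : IsPerfectColoring G f A) : HasIntegralClassSizes A (Fintype.card V) := by
  -- Both sides count the ordered pairs of adjacent vertices of colors `i` and `j`.
  have key : ∀ i j, (Finset.univ.filter fun v => f v = i).card * A i j
      = ∑ v, ∑ w, if f v = i ∧ f w = j ∧ G.Adj v w then 1 else 0 := by
    intro i j
    rw [Finset.card_filter, Finset.sum_mul]
    refine Finset.sum_congr rfl fun v _ => ?_
    by_cases hv : f v = i
    · simp only [hv, if_true, one_mul, true_and]
      rw [← hv, ← h.2 v j, Finset.card_filter]
      exact Finset.sum_congr rfl fun w _ => by simp only [and_comm]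
    · simp [hv]
  refine ⟨fun i => (Finset.univ.filter fun v => f v = i).card, fun i => ?_, fun i j => ?_, ?_⟩
  · obtain ⟨v, hv⟩ := h.1 i
    exact Finset.card_pos.2 ⟨v, by simpa using hv⟩
  · dsimp only
    rw [key, key, Finset.sum_comm]
    refine Finset.sum_congr rfl fun v _ => Finset.sum_congr rfl fun w _ => ?_
    simp only [G.adj_comm v w]
    congr 1
    simp only [eq_iff_iff]
    tauto
  · exact (Finset.card_eq_sum_card_fiberwise (fun v _ => Finset.mem_coe.2 (Finset.mem_univ (f v)))).symm

theorem HasIntegralClassSizes.weaklySymmetric {A : Matrix (Fin m) (Fin m) ℕ} {n : ℕ}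
    (h : HasIntegralClassSizes A n) : WeaklySymmetric A := by
  obtain ⟨v, hv, hA, -⟩ := h
  have : ∀ i j, A i j = 0 → A j i = 0 := fun i j hij => by
    have := hA i j
    rw [hij, mul_zero, eq_comm, mul_eq_zero] at this
    exact this.resolve_left (hv j).ne'
  exact fun i j => ⟨this i j, this j i⟩

/-- Multiplying the balance equations along the cycle, the sizes on the two sides are the same up to
reordering, and they are positive and cancel. -/
theorem HasIntegralClassSizes.consistent {A : Matrix (Fin m) (Fin m) ℕ} {n : ℕ}
    (h : HasIntegralClassSizes A n) : Consistent A := by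
  obtain ⟨v, hv, hA, -⟩ := h
  intro c _
  have h1 : ∏ i ∈ c.support, v (c i) = ∏ i ∈ c.support, v i :=
    Finset.prod_equiv c (by simp) (fun _ _ => rfl)
  have h2 : (∏ i ∈ c.support, v i) * ∏ i ∈ c.support, A i (c i)
      = (∏ i ∈ c.support, v i) * ∏ i ∈ c.support, A (c i) i := by
    conv_rhs => rw [← h1]
    rw [← Finset.prod_mul_distrib, ← Finset.prod_mul_distrib]
    exact Finset.prod_congr rfl fun i _ => hA i (c i)
  exact Nat.eq_of_mul_eq_mul_left (Finset.prod_pos fun i _ => hv i) h2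

omit [DecidableEq V] in
theorem IsPerfectColoring.blockIrreducible {f : V → Fin m} {A : Matrix (Fin m) (Fin m) ℕ}
    (h : IsPerfectColoring G f A) (hG : G.Connected) : BlockIrreducible A := by
  rintro ⟨S, ⟨i, hi⟩, ⟨j, hj⟩, hS⟩
  obtain ⟨v, rfl⟩ := h.1 i
  obtain ⟨w, rfl⟩ := h.1 j
  obtain ⟨p⟩ := hG.preconnected v w
  induction p with
  | nil => exact hj hi
  | @cons a b c hab _ ih =>
    refine ih ?_ hj
    by_contra hb
    have h0 := (hS (f a) hi (f b) hb).1
    rw [← h.2 a (f b), Finset.card_eq_zero] at h0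
    exact Finset.notMem_empty b (h0 ▸ by simp [hab])

omit [DecidableEq V] in
theorem IsPerfectColoring.row_sum {f : V → Fin m} {A : Matrix (Fin m) (Fin m) ℕ}
    (h : IsPerfectColoring G f A) (v : V) : ∑ j, A (f v) j = G.degree v := by
  rw [← G.card_neighborFinset_eq_degree,
    Finset.card_eq_sum_card_fiberwise (f := f) (t := Finset.univ) (by intro; simp)]
  refine Finset.sum_congr rfl fun j _ => ?_
  rw [← h.2 v j]
  congr 1
  ext w
  simp

theorem isCandidate_of_charpoly_dvd {k : ℕ} (hreg : ∀ v, G.degree v = k)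
    {A : Matrix (Fin m) (Fin m) ℕ} (hrow : ∀ i, ∑ j, A i j = k) (hirr : BlockIrreducible A)
    (hsize : HasIntegralClassSizes A (Fintype.card V))
    (hdvd : (A.map (fun a : ℕ => (a : ℂ))).charpoly ∣ (G.adjMatrix ℂ).charpoly) :
    IsCandidate G A where
  row_sum i v := by rw [hrow, hreg]
  weaklySymmetric := hsize.weaklySymmetric
  consistent := hsize.consistent
  irreducible := hirr
  classSizes := hsize
  eigenvalues := spectrum_subset_of_charpoly_dvd hdvd

theorem IsPerfectColoring.isCandidate {k : ℕ} (hreg : ∀ v, G.degree v = k) (hG : G.Connected)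
    {f : V → Fin m} {A : Matrix (Fin m) (Fin m) ℕ} (h : IsPerfectColoring G f A) :
    IsCandidate G A := by
  refine isCandidate_of_charpoly_dvd hreg (fun i => ?_) (h.blockIrreducible hG)
    h.hasIntegralClassSizes h.charpoly_dvd
  obtain ⟨v, rfl⟩ := h.1 i
  rw [h.row_sum, hreg]

/-! ### Invariance under permutations of the colors -/

theorem ColorEquivalent.symm {A B : Matrix (Fin m) (Fin m) ℕ} (h : ColorEquivalent A B) :
    ColorEquivalent B A := by
  obtain ⟨σ, rfl⟩ := h
  exact ⟨σ.symm, by ext; simp⟩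

theorem ColorEquivalent.trans {A B D : Matrix (Fin m) (Fin m) ℕ} (h : ColorEquivalent A B)
    (h' : ColorEquivalent B D) : ColorEquivalent A D := by
  obtain ⟨σ, rfl⟩ := h
  obtain ⟨τ, rfl⟩ := h'
  exact ⟨σ.trans τ, by ext; simp⟩

theorem ColorEquivalent.charpoly_eq {A B : Matrix (Fin m) (Fin m) ℕ} (h : ColorEquivalent A B) :
    (A.map (fun a : ℕ => (a : ℂ))).charpoly = (B.map (fun a : ℕ => (a : ℂ))).charpoly := by
  obtain ⟨σ, rfl⟩ := h
  rw [← Matrix.charpoly_reindex σ.symm (B.map _)]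
  rfl

theorem BlockIrreducible.submatrix {A : Matrix (Fin m) (Fin m) ℕ} (h : BlockIrreducible A)
    (σ : Equiv.Perm (Fin m)) : BlockIrreducible (A.submatrix σ σ) := by
  rintro ⟨S, ⟨i, hi⟩, ⟨j, hj⟩, hS⟩
  refine h ⟨σ.symm ⁻¹' S, ⟨σ i, by simpa⟩, ⟨σ j, by simpa using hj⟩, fun a ha b hb => ?_⟩
  simpa using hS (σ.symm a) ha (σ.symm b) hb

theorem HasIntegralClassSizes.submatrix {A : Matrix (Fin m) (Fin m) ℕ} {n : ℕ}
    (h : HasIntegralClassSizes A n) (σ : Equiv.Perm (Fin m)) :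
    HasIntegralClassSizes (A.submatrix σ σ) n := by
  obtain ⟨v, hv, hA, hn⟩ := h
  exact ⟨v ∘ σ, fun i => hv _, fun i j => hA _ _, by rw [← hn]; exact Equiv.sum_comp σ v⟩

theorem IsCandidate.of_colorEquivalent {A B : Matrix (Fin m) (Fin m) ℕ}
    (hB : IsCandidate G B) (h : ColorEquivalent A B) : IsCandidate G A := by
  have hcp := h.charpoly_eq
  obtain ⟨σ, rfl⟩ := h
  have hs := hB.classSizes.submatrix σ
  refine ⟨fun i v => ?_, hs.weaklySymmetric, hs.consistent, hB.irreducible.submatrix σ, hs, ?_⟩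
  · rw [← hB.row_sum (σ i) v]
    exact Equiv.sum_comp σ (B (σ i))
  · exact (spectrum_subset_of_charpoly_dvd hcp.dvd).trans hB.eigenvalues

omit [DecidableEq V] in
theorem colorAdjacencyMatrices_of_colorEquivalent {A B : Matrix (Fin m) (Fin m) ℕ}
    (hB : B ∈ colorAdjacencyMatrices G m) (h : ColorEquivalent A B) :
    A ∈ colorAdjacencyMatrices G m := by
  obtain ⟨f, hf, hc⟩ := hB
  obtain ⟨σ, rfl⟩ := h
  refine ⟨σ.symm ∘ f, σ.symm.surjective.comp hf, fun v j => ?_⟩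
  simp [Equiv.symm_apply_eq, hc v]

theorem listsCandidates_of {L : List (Matrix (Fin m) (Fin m) ℕ)}
    (hcomplete : ∀ A : Matrix (Fin m) (Fin m) ℕ, IsCandidate G A → ∃ B ∈ L, ColorEquivalent A B)
    (hcand : ∀ B ∈ L, IsCandidate G B ∧
      (B.map (fun a : ℕ => (a : ℂ))).charpoly ∣ (G.adjMatrix ℂ).charpoly)
    (hL : L.Pairwise fun A B => ¬ ColorEquivalent A B) : ListsCandidates G L := by
  refine ⟨⟨fun A => ⟨hcomplete A, ?_⟩, hL⟩, fun A hA => ?_⟩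
  · rintro ⟨B, hB, h⟩
    exact (hcand B hB).1.of_colorEquivalent h
  · obtain ⟨B, hB, h⟩ := hcomplete A hA
    rw [h.charpoly_eq]
    exact (hcand B hB).2

omit [DecidableEq V] in
theorem listsUpToColors_colorAdjacencyMatrices {L : List (Matrix (Fin m) (Fin m) ℕ)}
    (hcomplete : ∀ A ∈ colorAdjacencyMatrices G m, ∃ B ∈ L, ColorEquivalent A B)
    (hreal : ∀ B ∈ L, B ∈ colorAdjacencyMatrices G m)
    (hL : L.Pairwise fun A B => ¬ ColorEquivalent A B) :
    ListsUpToColors L (colorAdjacencyMatrices G m) :=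
  ⟨fun A => ⟨hcomplete A, fun ⟨B, hB, h⟩ =>
    colorAdjacencyMatrices_of_colorEquivalent (hreal B hB) h⟩, hL⟩

/-- Realized matrices are candidates, so completeness for candidates and a coloring for each listed
matrix settle both classifications at once. -/
theorem listsCandidatesAllRealized_of {k : ℕ} (hreg : ∀ v, G.degree v = k) (hG : G.Connected)
    {L : List (Matrix (Fin m) (Fin m) ℕ)}
    (hcomplete : ∀ A : Matrix (Fin m) (Fin m) ℕ, IsCandidate G A → ∃ B ∈ L, ColorEquivalent A B)
    (hreal : ∀ B ∈ L, B ∈ colorAdjacencyMatrices G m)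
    (hL : L.Pairwise fun A B => ¬ ColorEquivalent A B) : ListsCandidatesAllRealized G L := by
  refine ⟨listsCandidates_of hcomplete (fun B hB => ?_) hL,
    listsUpToColors_colorAdjacencyMatrices (fun A ⟨f, hf⟩ => hcomplete A (hf.isCandidate hreg hG))
      hreal hL⟩
  obtain ⟨f, hf⟩ := hreal B hB
  exact ⟨hf.isCandidate hreg hG, hf.charpoly_dvd⟩

/-! ### Candidates are annihilated by polynomials that annihilate the graph -/

/-- A self-adjoint operator for a positive definite form has no nilpotent part: `N * N = 0` gives
`Nᵀ * D * N = 0`, whose diagonal entries are positively weighted sums of squares. -/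
theorem Matrix.eq_zero_of_isNilpotent_of_weighted_symmetric {M : Matrix (Fin m) (Fin m) ℤ}
    {v : Fin m → ℤ} (hv : ∀ i, 0 < v i) (hM : ∀ i j, v i * M i j = v j * M j i)
    (h : IsNilpotent M) : M = 0 := by
  have hD : ∀ N : Matrix (Fin m) (Fin m) ℤ, diagonal v * N = Nᵀ * diagonal v →
      N * N = 0 → N = 0 := by
    intro N h1 h2
    have h3 : Nᵀ * diagonal v * N = 0 := by rw [← h1, Matrix.mul_assoc, h2, Matrix.mul_zero]
    ext i j
    have h4 := congrFun (congrFun h3 j) j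
    rw [Matrix.mul_apply] at h4
    simp only [Matrix.mul_diagonal, Matrix.transpose_apply, Matrix.zero_apply] at h4
    rw [Finset.sum_eq_zero_iff_of_nonneg
      (fun k _ => by nlinarith [hv k, sq_nonneg (N k j), mul_nonneg (hv k).le (sq_nonneg (N k j))])] at h4
    have h5 := h4 i (Finset.mem_univ i)
    simpa [(hv i).ne'] using h5
  have hS : diagonal v * M = Mᵀ * diagonal v := by
    ext i j
    simp only [Matrix.diagonal_mul, Matrix.mul_diagonal, Matrix.transpose_apply, hM i j, mul_comm]
  have hP : ∀ k : ℕ, diagonal v * M ^ k = (M ^ k)ᵀ * diagonal v := by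
    intro k
    induction k with
    | zero => simp
    | succ k ih =>
      rw [pow_succ, ← Matrix.mul_assoc, ih, Matrix.mul_assoc, hS, ← Matrix.mul_assoc,
        ← Matrix.transpose_mul, ← pow_succ', pow_succ]
  obtain ⟨k, hk⟩ := h
  -- Powers of `M` are self-adjoint too, so the square-zero case halves the exponent repeatedly.
  have hQ : ∀ a : ℕ, M ^ 2 ^ a = 0 → M = 0 := by
    intro a
    induction a with
    | zero => simp
    | succ a ih =>
      intro h0
      exact ih (hD _ (hP _) (by rw [← pow_add, ← two_mul, ← pow_succ', h0]))
  exact hQ k (pow_eq_zero_of_le Nat.lt_two_pow_self.le hk)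

theorem Matrix.isNilpotent_of_spectrum_subset {M : Matrix (Fin m) (Fin m) ℂ}
    (h : spectrum ℂ M ⊆ {0}) : IsNilpotent M := by
  have h0 : M.charpoly = X ^ m := by
    have hs := (IsAlgClosed.splits M.charpoly).eq_prod_roots_of_monic M.charpoly_monic
    have hr : M.charpoly.roots = Multiset.replicate m 0 := by
      rw [Multiset.eq_replicate]
      constructor
      · rw [← (IsAlgClosed.splits M.charpoly).natDegree_eq_card_roots,
          Matrix.charpoly_natDegree_eq_dim, Fintype.card_fin]
      · intro b hb
        exact h (Matrix.mem_spectrum_of_isRoot_charpoly (isRoot_of_mem_roots hb))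
    rw [hs, hr]
    simp
  refine ⟨m, ?_⟩
  have := Matrix.aeval_self_charpoly M
  rwa [h0, map_pow, aeval_X] at this

theorem aeval_weighted_symmetric {A : Matrix (Fin m) (Fin m) ℤ} {v : Fin m → ℤ}
    (hA : ∀ i j, v i * A i j = v j * A j i) (p : ℤ[X]) (i j : Fin m) :
    v i * aeval A p i j = v j * aeval A p j i := by
  have hS : diagonal v * A = Aᵀ * diagonal v := by
    ext i j
    simp only [Matrix.diagonal_mul, Matrix.mul_diagonal, Matrix.transpose_apply, hA i j, mul_comm]
  have hp : diagonal v * aeval A p = (aeval A p)ᵀ * diagonal v := by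
    induction p using Polynomial.induction_on' with
    | add p q hp hq => simp [Matrix.mul_add, Matrix.add_mul, hp, hq]
    | monomial k a =>
      have hk : diagonal v * A ^ k = (A ^ k)ᵀ * diagonal v := by
        induction k with
        | zero => simp
        | succ k ih =>
          rw [pow_succ, ← Matrix.mul_assoc, ih, Matrix.mul_assoc, hS, ← Matrix.mul_assoc,
            ← Matrix.transpose_mul, ← pow_succ', pow_succ]
      rw [aeval_monomial, ← Algebra.smul_def, Matrix.transpose_smul, Matrix.mul_smul, hk,
        Matrix.smul_mul]
  have := congrFun (congrFun hp i) j
  simpa only [Matrix.diagonal_mul, Matrix.mul_diagonal, Matrix.transpose_apply, mul_comm] using this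

/-- By spectral mapping the eigenvalues of `p(A)` are among those of `p` at the adjacency matrix,
hence all zero, so `p(A)` is nilpotent; the class sizes make it self-adjoint. Irrational eigenvalues
never have to be named. -/
theorem IsCandidate.aeval_eq_zero {A : Matrix (Fin m) (Fin m) ℕ} (h : IsCandidate G A) {p : ℤ[X]}
    (hp : aeval (G.adjMatrix ℤ) p = 0) : aeval (A.map (fun a : ℕ => (a : ℤ))) p = 0 := by
  obtain ⟨v, hv, hA, -⟩ := h.classSizes
  have hmap : ∀ {n : Type} [Fintype n] [DecidableEq n] (B : Matrix n n ℤ),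
      aeval (B.map (Int.cast : ℤ → ℂ)) (p.map (algebraMap ℤ ℂ))
        = (aeval B p).map (Int.cast : ℤ → ℂ) := by
    intro n _ _ B
    rw [aeval_map_algebraMap]
    exact aeval_algHom_apply ((Algebra.ofId ℤ ℂ).mapMatrix) B p
  refine Matrix.eq_zero_of_isNilpotent_of_weighted_symmetric (v := fun i => (v i : ℤ))
    (fun i => by exact_mod_cast hv i)
    (aeval_weighted_symmetric (fun i j => by
      simp only [Matrix.map_apply]
      exact_mod_cast hA i j) p) ?_
  have hadj : (G.adjMatrix ℤ).map (Int.cast : ℤ → ℂ) = G.adjMatrix ℂ := by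
    ext i j
    simp [SimpleGraph.adjMatrix_apply]
  have hAc : (A.map (fun a : ℕ => (a : ℤ))).map (Int.cast : ℤ → ℂ) = A.map (fun a : ℕ => (a : ℂ)) := by
    ext i j
    simp
  have hnil : IsNilpotent ((aeval (A.map (fun a : ℕ => (a : ℤ))) p).map (Int.cast : ℤ → ℂ)) := by
    rcases isEmpty_or_nonempty (Fin m) with hm | hm
    · exact ⟨0, Subsingleton.elim _ _⟩
    apply Matrix.isNilpotent_of_spectrum_subset
    rw [← hmap, hAc, spectrum.map_polynomial_aeval_of_nonempty _ _
      (spectrum.nonempty_of_isAlgClosed_of_finiteDimensional ℂ _)]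
    rintro _ ⟨r, hr, rfl⟩
    have h1 := spectrum.subset_polynomial_aeval (𝕜 := ℂ) (G.adjMatrix ℂ) (p.map (algebraMap ℤ ℂ))
      ⟨r, h.eigenvalues hr, rfl⟩
    rw [← hadj, hmap, hp] at h1
    -- Without vertices the matrix algebra is trivial and its spectrum empty, contradicting `h1`.
    have : Nonempty V := by
      by_contra hV
      rw [not_nonempty_iff] at hV
      simp at h1
    simpa using h1
  obtain ⟨k, hk⟩ := hnil
  refine ⟨k, ?_⟩
  have hinj : Function.Injective (fun B : Matrix (Fin m) (Fin m) ℤ => B.map (Int.cast : ℤ → ℂ)) :=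
    Matrix.map_injective Int.cast_injective
  apply hinj
  have := map_pow ((Int.castRingHom ℂ).mapMatrix (m := Fin m)) (aeval (A.map (fun a : ℕ => (a : ℤ))) p) k
  refine this.trans (hk.trans ?_)
  ext
  simp

/-! ### Distance partitions -/

/-- `D v` partitions the vertices by their distance from `v`, and each of these partitions is
perfect with matrix `N`. -/
structure IsDistancePartition {V : Type} [Fintype V] (G : SimpleGraph V) [DecidableRel G.Adj]
    {d : ℕ} (D : V → V → Fin (d + 1)) (N : Matrix (Fin (d + 1)) (Fin (d + 1)) ℕ) : Prop where
  eq_zero_iff : ∀ v w, D v w = 0 ↔ v = w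
  card_eq : ∀ v w j, (Finset.univ.filter fun u => G.Adj w u ∧ D v u = j).card = N (D v w) j

variable {d : ℕ} {D : V → V → Fin (d + 1)} {N : Matrix (Fin (d + 1)) (Fin (d + 1)) ℕ}

omit [DecidableEq V] in
theorem IsDistancePartition.connected [Nonempty V] (h : IsDistancePartition G D N)
    (hN : ∀ i : Fin (d + 1), i ≠ 0 → ∃ j : Fin (d + 1), j < i ∧ 0 < N i j) : G.Connected := by
  refine ⟨fun v w => ?_⟩
  generalize hi : D v w = i
  induction i using WellFoundedLT.induction generalizing w with
  | ind i ih =>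
    by_cases h0 : i = 0
    · rw [h0, h.eq_zero_iff] at hi
      rw [hi]
    · obtain ⟨j, hj, hN⟩ := hN i h0
      rw [← hi, ← h.card_eq, Finset.card_pos] at hN
      obtain ⟨u, hu⟩ := hN
      simp only [Finset.mem_filter, Finset.mem_univ, true_and] at hu
      exact (ih j hj u hu.2).trans hu.1.symm.reachable

/-- The class at distance 0 from `v` is `{v}`, so column `v` of `p` at the adjacency matrix is a
column of `p(G) * P = P * p(N)`. Letting `v` vary covers every column. -/
theorem IsDistancePartition.aeval_adjMatrix_eq_zero (h : IsDistancePartition G D N) {p : ℤ[X]}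
    (hp : aeval (N.map (fun a : ℕ => (a : ℤ))) p = 0) : aeval (G.adjMatrix ℤ) p = 0 := by
  ext w v
  have h1 := adjMatrix_mul_colorIndicator (R := ℤ) (h.card_eq v)
  have h2 : aeval (G.adjMatrix ℤ) p * colorIndicator ℤ (D v)
      = colorIndicator ℤ (D v) * aeval (N.map (fun a : ℕ => (a : ℤ))) p := by
    generalize colorIndicator ℤ (D v) = P at h1
    clear hp
    induction p using Polynomial.induction_on' with
    | add p q hp hq => simp [Matrix.mul_add, Matrix.add_mul, hp, hq]
    | monomial k a =>
      have hk : (G.adjMatrix ℤ) ^ k * P = P * (N.map (fun a : ℕ => (a : ℤ))) ^ k := by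
        induction k with
        | zero => simp
        | succ k ih =>
          rw [pow_succ', Matrix.mul_assoc, ih, ← Matrix.mul_assoc, h1, Matrix.mul_assoc, ← pow_succ']
      simp only [aeval_monomial, ← Algebra.smul_def, Matrix.mul_smul, hk, Matrix.smul_mul]
  rw [hp, Matrix.mul_zero] at h2
  have h3 := congrFun (congrFun h2 w) 0
  simpa [Matrix.mul_apply, colorIndicator, h.eq_zero_iff] using h3

end

/-! ### A search through all candidates -/

/-- The value of `K` at `a`, where the kernel evaluates `a` before it substitutes it into `K`. -/
def evaluating (a : ℕ) (K : ℕ → Bool) : Bool :=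
  match a with
  | 0 => K 0
  | n + 1 => K (n + 1)

theorem evaluating_eq (a : ℕ) (K : ℕ → Bool) : evaluating a K = K a := by
  cases a <;> rfl

/-- The value of `K` at `l`, where the kernel evaluates the members of `l` first. -/
def evaluatingList : List ℕ → (List ℕ → Bool) → Bool
  | [], K => K []
  | a :: l, K => evaluating a fun a => evaluatingList l fun l => K (a :: l)

theorem evaluatingList_eq (l : List ℕ) (K : List ℕ → Bool) : evaluatingList l K = K l := by
  induction l generalizing K with
  | nil => rfl
  | cons a l ih => rw [evaluatingList, evaluating_eq, ih]

/-- The value of `K` at `l`, where the kernel evaluates the entries of the members of `l` first. -/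
def evaluatingLists : List (List ℕ) → (List (List ℕ) → Bool) → Bool
  | [], K => K []
  | a :: l, K => evaluatingList a fun a => evaluatingLists l fun l => K (a :: l)

theorem evaluatingLists_eq (l : List (List ℕ)) (K : List (List ℕ) → Bool) :
    evaluatingLists l K = K l := by
  induction l generalizing K with
  | nil => rfl
  | cons a l ih => rw [evaluatingLists, evaluatingList_eq, ih]

/-- The implication from `p` to `K`; if `p` is false, then `K` is not evaluated. -/
def guarded (p K : Bool) : Bool := !p || K

theorem guarded_eq_true {p K : Bool} : guarded p K = true ↔ (p = true → K = true) := by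
  cases p <;> simp [guarded]

/-- `K a b` holds for all `a, b ≤ k` with `x * a = y * b`. -/
def forallBalanced (k x y : ℕ) (K : ℕ → ℕ → Bool) : Bool :=
  (List.range (k + 1)).all fun a => guarded (Nat.beq (x * a % y) 0) <|
    evaluating (x * a / y) fun b => guarded (Nat.ble b k) (K a b)

/-- Since `y` is positive, `b` is determined by `a`, so one loop over `a` suffices. -/
theorem forallBalanced_apply {k x y a b : ℕ} {K : ℕ → ℕ → Bool}
    (h : forallBalanced k x y K = true) (hy : 0 < y) (ha : a ≤ k) (hb : b ≤ k)
    (hab : x * a = y * b) : K a b = true := by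
  simp only [forallBalanced, List.all_eq_true, List.mem_range, guarded_eq_true, evaluating_eq,
    Nat.beq_eq, Nat.ble_eq] at h
  have h' := h a (by omega)
  rw [hab, Nat.mul_mod_right, Nat.mul_div_cancel_left _ hy] at h'
  exact h' rfl hb

/-- Whether `T` holds for all irreducible matrices with row sums `k` that are balanced by two class
sizes in increasing order with sum `n`. -/
def searchTwo (n k : ℕ) (T : Matrix (Fin 2) (Fin 2) ℕ → Bool) : Bool :=
  (List.range (n + 1)).all fun x => evaluating (n - x) fun y =>
    guarded (Nat.ble 1 x && Nat.ble x y) <|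
    forallBalanced k x y fun a b => guarded (Nat.ble 1 a) <| T !![k - a, a; b, k - b]

/-- The analogue of `searchTwo` for three classes. -/
def searchThree (n k : ℕ) (T : Matrix (Fin 3) (Fin 3) ℕ → Bool) : Bool :=
  (List.range (n + 1)).all fun x => guarded (Nat.ble 1 x) <|
    (List.range (n + 1)).all fun y => guarded (Nat.ble x y) <|
    evaluating (n - x - y) fun z => guarded (Nat.ble y z) <|
    forallBalanced k x y fun xy yx =>
    forallBalanced k x z fun xz zx =>
    guarded (Nat.ble (xy + xz) k && Nat.ble 1 (xy + xz)) <|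
    forallBalanced k y z fun yz zy =>
    guarded (Nat.ble (yx + yz) k && Nat.ble (zx + zy) k &&
      Nat.ble 1 (xy + yz) && Nat.ble 1 (xz + yz)) <|
    T !![k - (xy + xz), xy, xz; yx, k - (yx + yz), yz; zx, zy, k - (zx + zy)]

/-- The analogue of `searchTwo` for four classes. -/
def searchFour (n k : ℕ) (T : Matrix (Fin 4) (Fin 4) ℕ → Bool) : Bool :=
  (List.range (n + 1)).all fun x => guarded (Nat.ble 1 x) <|
    (List.range (n + 1)).all fun y => guarded (Nat.ble x y) <|
    (List.range (n + 1)).all fun z => guarded (Nat.ble y z) <|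
    evaluating (n - x - y - z) fun w => guarded (Nat.ble z w) <|
    forallBalanced k x y fun xy yx =>
    forallBalanced k x z fun xz zx =>
    guarded (Nat.ble (xy + xz) k) <|
    forallBalanced k x w fun xw wx =>
    guarded (Nat.ble (xy + xz + xw) k && Nat.ble 1 (xy + xz + xw)) <|
    forallBalanced k y z fun yz zy =>
    guarded (Nat.ble (yx + yz) k && Nat.ble (zx + zy) k) <|
    forallBalanced k y w fun yw wy =>
    guarded (Nat.ble (yx + yz + yw) k && Nat.ble 1 (xy + yz + yw) &&
      Nat.ble 1 (xz + xw + yz + yw)) <|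
    forallBalanced k z w fun zw wz =>
    guarded (Nat.ble (zx + zy + zw) k && Nat.ble (wx + wy + wz) k &&
      Nat.ble 1 (xz + yz + zw) && Nat.ble 1 (xw + yw + zw) &&
      Nat.ble 1 (xy + xw + yz + zw) && Nat.ble 1 (xy + xz + yw + zw)) <|
    T !![k - (xy + xz + xw), xy, xz, xw; yx, k - (yx + yz + yw), yz, yw;
      zx, zy, k - (zx + zy + zw), zw; wx, wy, wz, k - (wx + wy + wz)]

/-- `T` holds for all matrices with row sums `k` that satisfy the combinatorial conditions for
classes that are in the order of their sizes. -/
def HoldsForSorted (n k : ℕ) {m : ℕ} (T : Matrix (Fin m) (Fin m) ℕ → Bool) : Prop :=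
  ∀ (A : Matrix (Fin m) (Fin m) ℕ) (v : Fin m → ℕ), (∀ i, ∑ j, A i j = k) → (∀ i, 0 < v i) →
    Monotone v → (∀ i j, v i * A i j = v j * A j i) → ∑ i, v i = n → BlockIrreducible A →
    T A = true

theorem BlockIrreducible.exists_ne_zero {m : ℕ} {A : Matrix (Fin m) (Fin m) ℕ}
    (h : BlockIrreducible A) (hw : WeaklySymmetric A) {S : Finset (Fin m)} (h0 : S.Nonempty)
    (h1 : Sᶜ.Nonempty) : ∃ i ∈ S, ∃ j ∈ Sᶜ, A i j ≠ 0 := by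
  by_contra! hS
  refine h ⟨S, h0, ?_, fun i hi j hj => ?_⟩
  · rw [← Finset.coe_compl]
    exact h1
  · have := hS i hi j (by simpa using hj)
    exact ⟨this, (hw i j).1 this⟩

/-- Only entries above the diagonal appear, because these are the entries that the searches test for
crossing a cut. -/
theorem BlockIrreducible.sum_ne_zero {m : ℕ} {A : Matrix (Fin m) (Fin m) ℕ}
    (h : BlockIrreducible A) (hw : WeaklySymmetric A) {S : Finset (Fin m)} (h0 : S.Nonempty)
    (h1 : Sᶜ.Nonempty) : ∑ i ∈ S, ∑ j ∈ Sᶜ, A (min i j) (max i j) ≠ 0 := by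
  obtain ⟨i, hi, j, hj, hA⟩ := h.exists_ne_zero hw h0 h1
  intro h2
  have h3 := Finset.sum_eq_zero_iff.1 (Finset.sum_eq_zero_iff.1 h2 i hi) j hj
  rcases le_total i j with hij | hij
  · rw [min_eq_left hij, max_eq_right hij] at h3
    exact hA h3
  · rw [min_eq_right hij, max_eq_left hij] at h3
    exact hA ((hw j i).1 h3)

theorem holdsForSorted_of_searchTwo {n k : ℕ} {T : Matrix (Fin 2) (Fin 2) ℕ → Bool}
    (h : searchTwo n k T = true) : HoldsForSorted n k T := by
  intro A v hrow hv hmono hA hn hirr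
  have hw : WeaklySymmetric A := HasIntegralClassSizes.weaklySymmetric ⟨v, hv, hA, hn⟩
  have s0 := hirr.sum_ne_zero hw (S := {0}) (by decide) (by decide)
  rw [show ({0}ᶜ : Finset (Fin 2)) = {1} by decide] at s0
  have r0 := hrow 0
  have r1 := hrow 1
  have v0 := hv 0
  have v1 := hv 1
  have m0 : v 0 ≤ v 1 := hmono (by decide)
  simp [Fin.sum_univ_succ] at r0 r1 hn s0
  simp only [searchTwo, List.all_eq_true, List.mem_range, guarded_eq_true, evaluating_eq,
    Nat.ble_eq, Bool.and_eq_true] at h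
  have h := h (v 0) (by omega)
  rw [show n - v 0 = v 1 by omega] at h
  have h := forallBalanced_apply (h ⟨v0, m0⟩) v1 (by omega) (by omega) (hA 0 1)
  rw [guarded_eq_true] at h
  have h := h (by simp; omega)
  convert h using 1
  congr 1
  ext i j
  fin_cases i <;> fin_cases j <;> simp <;> omega

theorem holdsForSorted_of_searchThree {n k : ℕ} {T : Matrix (Fin 3) (Fin 3) ℕ → Bool}
    (h : searchThree n k T = true) : HoldsForSorted n k T := by
  intro A v hrow hv hmono hA hn hirr
  have hw : WeaklySymmetric A := HasIntegralClassSizes.weaklySymmetric ⟨v, hv, hA, hn⟩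
  have s0 := hirr.sum_ne_zero hw (S := {0}) (by decide) (by decide)
  have s1 := hirr.sum_ne_zero hw (S := {1}) (by decide) (by decide)
  have s2 := hirr.sum_ne_zero hw (S := {2}) (by decide) (by decide)
  rw [show ({0}ᶜ : Finset (Fin 3)) = {1, 2} by decide] at s0
  rw [show ({1}ᶜ : Finset (Fin 3)) = {0, 2} by decide] at s1
  rw [show ({2}ᶜ : Finset (Fin 3)) = {0, 1} by decide] at s2
  have r0 := hrow 0
  have r1 := hrow 1
  have r2 := hrow 2
  have m0 : v 0 ≤ v 1 := hmono (by decide)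
  have m1 : v 1 ≤ v 2 := hmono (by decide)
  simp only [Fin.sum_univ_three] at r0 r1 r2 hn
  rw [Finset.sum_singleton, Finset.sum_pair (by decide)] at s0 s1 s2
  have e0 : A 0 1 + A 0 2 ≠ 0 := s0
  have e1 : A 0 1 + A 1 2 ≠ 0 := s1
  have e2 : A 0 2 + A 1 2 ≠ 0 := s2
  simp only [searchThree, List.all_eq_true, List.mem_range, guarded_eq_true, evaluating_eq,
    Nat.ble_eq] at h
  have h := h (v 0) (by omega) (hv 0) (v 1) (by omega) m0
  rw [show n - v 0 - v 1 = v 2 by omega] at h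
  have h := forallBalanced_apply (h m1) (hv 1) (by omega) (by omega) (hA 0 1)
  have h := forallBalanced_apply h (hv 2) (by omega) (by omega) (hA 0 2)
  rw [guarded_eq_true] at h
  have h := forallBalanced_apply (h (by simp; omega)) (hv 2) (by omega) (by omega) (hA 1 2)
  rw [guarded_eq_true] at h
  have h := h (by simp; omega)
  convert h using 1
  congr 1
  ext i j
  fin_cases i <;> fin_cases j <;> simp <;> omega

/-- Irreducibility means that every cut of the colors is crossed: up to complement, four cuts
isolate one color and three split the colors into pairs. These are the seven positivity guards of
the search. The diagonal is recovered from the row sums. -/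
theorem holdsForSorted_of_searchFour {n k : ℕ} {T : Matrix (Fin 4) (Fin 4) ℕ → Bool}
    (h : searchFour n k T = true) : HoldsForSorted n k T := by
  intro A v hrow hv hmono hA hn hirr
  have hw : WeaklySymmetric A := HasIntegralClassSizes.weaklySymmetric ⟨v, hv, hA, hn⟩
  have s0 := hirr.sum_ne_zero hw (S := {0}) (by decide) (by decide)
  have s1 := hirr.sum_ne_zero hw (S := {1}) (by decide) (by decide)
  have s2 := hirr.sum_ne_zero hw (S := {2}) (by decide) (by decide)
  have s3 := hirr.sum_ne_zero hw (S := {3}) (by decide) (by decide)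
  have s4 := hirr.sum_ne_zero hw (S := {0, 1}) (by decide) (by decide)
  have s5 := hirr.sum_ne_zero hw (S := {0, 2}) (by decide) (by decide)
  have s6 := hirr.sum_ne_zero hw (S := {0, 3}) (by decide) (by decide)
  rw [show ({0}ᶜ : Finset (Fin 4)) = insert 1 {2, 3} by decide] at s0
  rw [show ({1}ᶜ : Finset (Fin 4)) = insert 0 {2, 3} by decide] at s1
  rw [show ({2}ᶜ : Finset (Fin 4)) = insert 0 {1, 3} by decide] at s2
  rw [show ({3}ᶜ : Finset (Fin 4)) = insert 0 {1, 2} by decide] at s3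
  rw [show ({0, 1}ᶜ : Finset (Fin 4)) = {2, 3} by decide] at s4
  rw [show ({0, 2}ᶜ : Finset (Fin 4)) = {1, 3} by decide] at s5
  rw [show ({0, 3}ᶜ : Finset (Fin 4)) = {1, 2} by decide] at s6
  rw [Finset.sum_singleton, Finset.sum_insert (by decide), Finset.sum_pair (by decide)]
    at s0 s1 s2 s3
  rw [Finset.sum_pair (by decide), Finset.sum_pair (by decide), Finset.sum_pair (by decide)]
    at s4 s5 s6
  have e0 : A 0 1 + (A 0 2 + A 0 3) ≠ 0 := s0
  have e1 : A 0 1 + (A 1 2 + A 1 3) ≠ 0 := s1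
  have e2 : A 0 2 + (A 1 2 + A 2 3) ≠ 0 := s2
  have e3 : A 0 3 + (A 1 3 + A 2 3) ≠ 0 := s3
  have e4 : A 0 2 + A 0 3 + (A 1 2 + A 1 3) ≠ 0 := s4
  have e5 : A 0 1 + A 0 3 + (A 1 2 + A 2 3) ≠ 0 := s5
  have e6 : A 0 1 + A 0 2 + (A 1 3 + A 2 3) ≠ 0 := s6
  have r0 := hrow 0
  have r1 := hrow 1
  have r2 := hrow 2
  have r3 := hrow 3
  have m0 : v 0 ≤ v 1 := hmono (by decide)
  have m1 : v 1 ≤ v 2 := hmono (by decide)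
  have m2 : v 2 ≤ v 3 := hmono (by decide)
  simp only [Fin.sum_univ_four] at r0 r1 r2 r3 hn
  simp only [searchFour, List.all_eq_true, List.mem_range, guarded_eq_true, evaluating_eq,
    Nat.ble_eq] at h
  have h := h (v 0) (by omega) (hv 0) (v 1) (by omega) m0 (v 2) (by omega) m1
  rw [show n - v 0 - v 1 - v 2 = v 3 by omega] at h
  have h := forallBalanced_apply (h m2) (hv 1) (by omega) (by omega) (hA 0 1)
  have h := forallBalanced_apply h (hv 2) (by omega) (by omega) (hA 0 2)
  rw [guarded_eq_true] at h
  have h := forallBalanced_apply (h (by simp; omega)) (hv 3) (by omega) (by omega) (hA 0 3)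
  rw [guarded_eq_true] at h
  have h := forallBalanced_apply (h (by simp; omega)) (hv 2) (by omega) (by omega) (hA 1 2)
  rw [guarded_eq_true] at h
  have h := forallBalanced_apply (h (by simp; omega)) (hv 3) (by omega) (by omega) (hA 1 3)
  rw [guarded_eq_true] at h
  have h := forallBalanced_apply (h (by simp; omega)) (hv 3) (by omega) (by omega) (hA 2 3)
  rw [guarded_eq_true] at h
  have h := h (by simp; omega)
  convert h using 1
  congr 1
  ext i j
  fin_cases i <;> fin_cases j <;> simp <;> omega

/-! ### The test for the eigenvalues -/

/-- The polynomial with coefficients the differences of the members of the pairs in a list. -/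
noncomputable def differencePolynomial : List (ℕ × ℕ) → ℤ[X]
  | [] => 0
  | a :: c => C ((a.1 : ℤ) - a.2) + X * differencePolynomial c

/-- The dot product of two lists. -/
def dotList : List ℕ → List ℕ → ℕ
  | a :: l, b :: l' => a * b + dotList l l'
  | _, _ => 0

theorem dotList_ofFn {m : ℕ} (x y : Fin m → ℕ) :
    dotList (List.ofFn x) (List.ofFn y) = x ⬝ᵥ y := by
  induction m with
  | zero => simp [dotList]
  | succ m ih => simp [List.ofFn_succ, dotList, ih, dotProduct, Fin.sum_univ_succ]

/-- Whether `y * p(A) * x + s = t`, where `A` has the given rows and the coefficients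
of `p` are the differences of the members of the pairs in the list. -/
def testMoments (rows : List (List ℕ)) (y : List ℕ) :
    List (ℕ × ℕ) → List ℕ → ℕ → ℕ → Bool
  | [], _, s, t => Nat.beq s t
  | a :: c, x, s, t => evaluating (dotList y x) fun d =>
      evaluatingList (rows.map fun r => dotList r x) fun x' =>
        testMoments rows y c x' (s + a.1 * d) (t + a.2 * d)

/-- Each step replaces `x` by `A *ᵥ x`. The positive and negative parts of the coefficients
accumulate in `s` and `t`, so the evaluation stays in the natural numbers. -/
theorem testMoments_iff {m : ℕ} (A : Matrix (Fin m) (Fin m) ℕ) (y : Fin m → ℕ)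
    (c : List (ℕ × ℕ)) (x : Fin m → ℕ) (s t : ℕ) :
    testMoments (List.ofFn fun i => List.ofFn (A i)) (List.ofFn y) c (List.ofFn x) s t = true ↔
      (s : ℤ) + (fun i => (y i : ℤ)) ⬝ᵥ (aeval (A.map fun a : ℕ => (a : ℤ)) (differencePolynomial c)
        *ᵥ fun i => (x i : ℤ)) = t := by
  induction c generalizing x s t with
  | nil => simp [testMoments, differencePolynomial]
  | cons a c ih =>
    have hx : ((List.ofFn fun i => List.ofFn (A i)).map fun r => dotList r (List.ofFn x))
        = List.ofFn (A *ᵥ x) := by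
      rw [List.map_ofFn]
      congr 1
      ext i
      exact dotList_ofFn (A i) x
    have hAx : (fun i => (((A *ᵥ x) i : ℕ) : ℤ)) = A.map (fun a : ℕ => (a : ℤ)) *ᵥ fun i => (x i : ℤ) := by
      ext i
      simp [Matrix.mulVec, dotProduct]
    have hd : (((y ⬝ᵥ x : ℕ)) : ℤ) = (fun i => (y i : ℤ)) ⬝ᵥ fun i => (x i : ℤ) := by
      simp [dotProduct]
    have hp : aeval (A.map fun a : ℕ => (a : ℤ)) (differencePolynomial (a :: c))
        *ᵥ (fun i => (x i : ℤ)) = ((a.1 : ℤ) - a.2) • (fun i => (x i : ℤ)) +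
          aeval (A.map fun a : ℕ => (a : ℤ)) (differencePolynomial c) *ᵥ
            (A.map (fun a : ℕ => (a : ℤ)) *ᵥ fun i => (x i : ℤ)) := by
      rw [differencePolynomial, mul_comm X, map_add, map_mul, aeval_X, aeval_C, Matrix.add_mulVec,
        Matrix.mulVec_mulVec, Algebra.algebraMap_eq_smul_one, Matrix.smul_mulVec, Matrix.one_mulVec]
    rw [testMoments, evaluating_eq, evaluatingList_eq, hx, ih, hAx, hp, dotList_ofFn,
      dotProduct_add, dotProduct_smul, ← hd, smul_eq_mul]
    push_cast
    constructor <;> intro h <;> linarith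

/-- Weights such that no matrix in our searches passes the test by accident. -/
def testWeights (m : ℕ) : Fin m → ℕ := fun i => [1, 6, 20, 70].getD i 0

instance {m : ℕ} (A B : Matrix (Fin m) (Fin m) ℕ) : Decidable (ColorEquivalent A B) :=
  inferInstanceAs (Decidable (∃ σ : Equiv.Perm (Fin m), A = B.submatrix σ σ))

/-- Whether `A` fails to be annihilated by the polynomial with coefficients `c` or is in the list
`L`, up to a permutation of the colors. -/
def testCandidate {m : ℕ} (c : List (ℕ × ℕ)) (L : List (Matrix (Fin m) (Fin m) ℕ))
    (A : Matrix (Fin m) (Fin m) ℕ) : Bool :=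
  guarded (evaluatingLists (List.ofFn fun i => List.ofFn (A i)) fun rows =>
      evaluatingList (List.ofFn (testWeights m)) fun x => testMoments rows x c x 0 0) <|
    decide (∃ B ∈ L, ColorEquivalent A B)

theorem exists_colorEquivalent_of_holdsForSorted {V : Type} [Fintype V] [DecidableEq V]
    {G : SimpleGraph V} [DecidableRel G.Adj] [Nonempty V] {n k m : ℕ}
    (hcard : Fintype.card V = n) (hreg : ∀ v, G.degree v = k)
    {c : List (ℕ × ℕ)} (hc : aeval (G.adjMatrix ℤ) (differencePolynomial c) = 0)
    {L : List (Matrix (Fin m) (Fin m) ℕ)}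
    (hT : HoldsForSorted n k (testCandidate c L))
    (A : Matrix (Fin m) (Fin m) ℕ) (hA : IsCandidate G A) : ∃ B ∈ L, ColorEquivalent A B := by
  obtain ⟨v, hv, hbal, hn⟩ := hA.classSizes
  -- Renumbering the colors by class size brings the candidate into the range of the search.
  set σ := Tuple.sort v
  have hσ : ColorEquivalent (A.submatrix σ σ) A := ⟨σ, rfl⟩
  have hA' := hA.of_colorEquivalent hσ
  obtain ⟨u⟩ := ‹Nonempty V›
  have h := hT (A.submatrix σ σ) (v ∘ σ) (fun i => by rw [hA'.row_sum i u, hreg])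
    (fun i => hv _) (Tuple.monotone_sort v) (fun i j => hbal _ _)
    (by rw [← hcard, ← hn]; exact Equiv.sum_comp σ v) hA'.irreducible
  rw [testCandidate, guarded_eq_true, evaluatingLists_eq, evaluatingList_eq, testMoments_iff,
    hA'.aeval_eq_zero hc, decide_eq_true_iff] at h
  obtain ⟨B, hB, hAB⟩ := h (by simp)
  exact ⟨B, hB, hσ.symm.trans hAB⟩

/-! ### Computations in the Platonic graphs -/

/-- The values of the polynomials `differencePolynomial c` at integral matrices. -/
def hornerMatrix {m : ℕ} (N : Matrix (Fin m) (Fin m) ℤ) : List (ℕ × ℕ) → Matrix (Fin m) (Fin m) ℤ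
  | [] => 0
  | a :: c => diagonal (fun _ => (a.1 : ℤ) - a.2) + N * hornerMatrix N c

theorem aeval_differencePolynomial {m : ℕ} (N : Matrix (Fin m) (Fin m) ℤ) (c : List (ℕ × ℕ)) :
    aeval N (differencePolynomial c) = hornerMatrix N c := by
  induction c with
  | nil => simp [differencePolynomial, hornerMatrix]
  | cons a c ih =>
    rw [differencePolynomial, hornerMatrix, map_add, map_mul, aeval_X, ih, aeval_C]
    rfl

/-- The coloring that is given by the list of the colors of the vertices in the order of `index`. -/
def coloringOfList {V : Type} {m : ℕ} [NeZero m] (index : V → ℕ) (l : List (Fin m)) (v : V) :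
    Fin m :=
  l.getD (index v) 0

instance {V : Type} [Fintype V] [DecidableEq V] (G : SimpleGraph V) [DecidableRel G.Adj] {m : ℕ}
    (f : V → Fin m) (A : Matrix (Fin m) (Fin m) ℕ) : Decidable (IsPerfectColoring G f A) :=
  inferInstanceAs (Decidable ((∀ j, ∃ v, f v = j) ∧
    ∀ (v : V) (j : Fin m), (Finset.univ.filter fun w => G.Adj v w ∧ f w = j).card = A (f v) j))

theorem mem_colorAdjacencyMatrices_of_forall₂ {V : Type} [Fintype V] {G : SimpleGraph V}
    [DecidableRel G.Adj] {m : ℕ} {fs : List (V → Fin m)} {L : List (Matrix (Fin m) (Fin m) ℕ)}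
    (h : List.Forall₂ (IsPerfectColoring G) fs L) :
    ∀ B ∈ L, B ∈ colorAdjacencyMatrices G m := by
  induction h with
  | nil => simp
  | cons h _ ih =>
    intro B hB
    rcases List.mem_cons.1 hB with rfl | hB
    · exact ⟨_, h⟩
    · exact ih B hB

def cubeIndex (x : Fin 3 → Bool) : ℕ := (x 0).toNat + 2 * (x 1).toNat + 4 * (x 2).toNat

def octahedronIndex (x : Fin 3 × Bool) : ℕ := 2 * x.1 + x.2.toNat

def dodecahedronIndex (x : Fin 2 × Fin 10) : ℕ := 10 * x.1 + x.2

def icosahedronIndex : Fin 2 × Option (Fin 5) → ℕ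
  | (s, none) => 6 * s
  | (s, some i) => 6 * s + i + 1

def tetrahedronDistance (v w : Fin 4) : Fin 2 := if v = w then 0 else 1

def cubeDistance (v w : Fin 3 → Bool) : Fin 4 := Fin.ofNat 4 (hammingDist v w)

def octahedronDistance (v w : Fin 3 × Bool) : Fin 3 :=
  if v = w then 0 else if v.1 = w.1 then 2 else 1

/-- Rotation reduces the distance to a function of the index difference. The table for mixed rings
is invariant under negation and so serves both orders. -/
def dodecahedronDistance (v w : Fin 2 × Fin 10) : Fin 6 :=
  match v.1, w.1 with
  | 0, 0 => ![0, 1, 2, 3, 4, 5, 4, 3, 2, 1] (w.2 - v.2)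
  | 1, 1 => ![0, 3, 1, 4, 2, 5, 2, 4, 1, 3] (w.2 - v.2)
  | _, _ => ![1, 2, 2, 3, 3, 4, 3, 3, 2, 2] (w.2 - v.2)

def icosahedronDistance : Fin 2 × Option (Fin 5) → Fin 2 × Option (Fin 5) → Fin 4
  | (s, none), (t, none) => if s = t then 0 else 3
  | (s, none), (t, some _) => if s = t then 1 else 2
  | (s, some _), (t, none) => if s = t then 1 else 2
  | (s, some i), (t, some j) =>
    match s, t with
    -- The antiprism is twisted, so exchanging the two pentagons reverses the sign of the
    -- difference.
    | 0, 1 => ![1, 1, 2, 3, 2] (j - i)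
    | 1, 0 => ![1, 2, 3, 2, 1] (j - i)
    | _, _ => ![0, 1, 2, 2, 1] (j - i)

/-! ### The tetrahedron -/

/-- Constant term first: `(x - 3)(x + 1)`. -/
def tetrahedronCoefficients : List (ℕ × ℕ) :=
  [(0, 3), (0, 2), (1, 0)]

def tetrahedronIntersection : Matrix (Fin 2) (Fin 2) ℕ :=
  !![0, 3; 1, 2]

theorem tetrahedron_isDistancePartition :
    IsDistancePartition tetrahedronGraph tetrahedronDistance tetrahedronIntersection :=
  ⟨by decide +kernel, by decide +kernel⟩

theorem tetrahedron_connected : tetrahedronGraph.Connected :=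
  tetrahedron_isDistancePartition.connected fun i => by fin_cases i <;> decide

theorem tetrahedron_degree (v : _) : tetrahedronGraph.degree v = 3 := by
  revert v
  decide +kernel

theorem tetrahedron_aeval_eq_zero :
    aeval (tetrahedronGraph.adjMatrix ℤ) (differencePolynomial tetrahedronCoefficients) = 0 := by
  apply tetrahedron_isDistancePartition.aeval_adjMatrix_eq_zero
  rw [aeval_differencePolynomial]
  decide +kernel

/-- The kernel runs the exhaustive search, checks one coloring per listed matrix in the same order,
and separates the listed matrices by trying all color permutations. The other cases follow this
pattern, with some extra care for two colors on the octahedron. -/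
theorem tetrahedron_two_colors :
    ListsCandidatesAllRealized tetrahedronGraph (m := 2)
      [!![0, 3; 1, 2], !![1, 2; 2, 1]] := by
  refine listsCandidatesAllRealized_of tetrahedron_degree tetrahedron_connected
    (exists_colorEquivalent_of_holdsForSorted (n := 4) rfl tetrahedron_degree tetrahedron_aeval_eq_zero
      (holdsForSorted_of_searchTwo (by decide +kernel)))
    (mem_colorAdjacencyMatrices_of_forall₂ (fs :=
      [[0, 1, 1, 1],
        [0, 0, 1, 1]].map
        (coloringOfList Fin.val)) (by decide +kernel))
    (by decide +kernel)

theorem tetrahedron_three_colors :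
    ListsCandidatesAllRealized tetrahedronGraph (m := 3)
      [!![0, 1, 2; 1, 0, 2; 1, 1, 1]] := by
  refine listsCandidatesAllRealized_of tetrahedron_degree tetrahedron_connected
    (exists_colorEquivalent_of_holdsForSorted (n := 4) rfl tetrahedron_degree tetrahedron_aeval_eq_zero
      (holdsForSorted_of_searchThree (by decide +kernel)))
    (mem_colorAdjacencyMatrices_of_forall₂ (fs :=
      [[0, 1, 2, 2]].map
        (coloringOfList Fin.val)) (by decide +kernel))
    (by decide +kernel)

theorem tetrahedron_four_colors :
    ListsCandidatesAllRealized tetrahedronGraph (m := 4)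
      [!![0, 1, 1, 1; 1, 0, 1, 1; 1, 1, 0, 1; 1, 1, 1, 0]] := by
  refine listsCandidatesAllRealized_of tetrahedron_degree tetrahedron_connected
    (exists_colorEquivalent_of_holdsForSorted (n := 4) rfl tetrahedron_degree tetrahedron_aeval_eq_zero
      (holdsForSorted_of_searchFour (by decide +kernel)))
    (mem_colorAdjacencyMatrices_of_forall₂ (fs :=
      [[0, 1, 2, 3]].map
        (coloringOfList Fin.val)) (by decide +kernel))
    (by decide +kernel)

/-! ### The cube -/

/-- This is `(x ^ 2 - 9)(x ^ 2 - 1)`. -/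
def cubeCoefficients : List (ℕ × ℕ) :=
  [(9, 0), (0, 0), (0, 10), (0, 0), (1, 0)]

def cubeIntersection : Matrix (Fin 4) (Fin 4) ℕ :=
  !![0, 3, 0, 0; 1, 0, 2, 0; 0, 2, 0, 1; 0, 0, 3, 0]

theorem cube_isDistancePartition :
    IsDistancePartition cubeGraph cubeDistance cubeIntersection :=
  ⟨by decide +kernel, by decide +kernel⟩

theorem cube_connected : cubeGraph.Connected :=
  cube_isDistancePartition.connected fun i => by fin_cases i <;> decide

theorem cube_degree (v : _) : cubeGraph.degree v = 3 := by
  revert v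
  decide +kernel

theorem cube_aeval_eq_zero :
    aeval (cubeGraph.adjMatrix ℤ) (differencePolynomial cubeCoefficients) = 0 := by
  apply cube_isDistancePartition.aeval_adjMatrix_eq_zero
  rw [aeval_differencePolynomial]
  decide +kernel

theorem cube_two_colors :
    ListsCandidatesAllRealized cubeGraph (m := 2)
      [!![0, 3; 1, 2], !![0, 3; 3, 0], !![1, 2; 2, 1], !![2, 1; 1, 2]] := by
  refine listsCandidatesAllRealized_of cube_degree cube_connected
    (exists_colorEquivalent_of_holdsForSorted (n := 8) rfl cube_degree cube_aeval_eq_zero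
      (holdsForSorted_of_searchTwo (by decide +kernel)))
    (mem_colorAdjacencyMatrices_of_forall₂ (fs :=
      [[0, 1, 1, 1, 1, 1, 1, 0],
        [0, 1, 1, 0, 1, 0, 0, 1],
        [0, 0, 1, 1, 1, 1, 0, 0],
        [0, 0, 0, 0, 1, 1, 1, 1]].map
        (coloringOfList cubeIndex)) (by decide +kernel))
    (by decide +kernel)

theorem cube_three_colors :
    ListsCandidatesAllRealized cubeGraph (m := 3)
      [!![0, 1, 2; 1, 0, 2; 1, 1, 1], !![1, 0, 2; 0, 1, 2; 1, 1, 1]] := by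
  refine listsCandidatesAllRealized_of cube_degree cube_connected
    (exists_colorEquivalent_of_holdsForSorted (n := 8) rfl cube_degree cube_aeval_eq_zero
      (holdsForSorted_of_searchThree (by decide +kernel)))
    (mem_colorAdjacencyMatrices_of_forall₂ (fs :=
      [[0, 1, 2, 2, 2, 2, 1, 0],
        [0, 0, 2, 2, 2, 2, 1, 1]].map
        (coloringOfList cubeIndex)) (by decide +kernel))
    (by decide +kernel)

theorem cube_four_colors :
    ListsCandidatesAllRealized cubeGraph (m := 4)
      [!![0, 0, 0, 3; 0, 0, 3, 0; 0, 1, 0, 2; 1, 0, 2, 0], !![0, 0, 1, 2; 0, 0, 2, 1; 1, 2, 0, 0;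
        2, 1, 0, 0], !![0, 1, 1, 1; 1, 0, 1, 1; 1, 1, 0, 1; 1, 1, 1, 0], !![0, 1, 1, 1; 1, 0, 1,
        1; 1, 1, 1, 0; 1, 1, 0, 1], !![1, 0, 1, 1; 0, 1, 1, 1; 1, 1, 1, 0; 1, 1, 0, 1]] := by
  refine listsCandidatesAllRealized_of cube_degree cube_connected
    (exists_colorEquivalent_of_holdsForSorted (n := 8) rfl cube_degree cube_aeval_eq_zero
      (holdsForSorted_of_searchFour (by decide +kernel)))
    (mem_colorAdjacencyMatrices_of_forall₂ (fs :=
      [[0, 3, 3, 2, 3, 2, 2, 1],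
        [0, 2, 3, 1, 3, 1, 0, 2],
        [0, 1, 2, 3, 3, 2, 1, 0],
        [0, 1, 2, 2, 3, 3, 1, 0],
        [0, 0, 2, 2, 3, 3, 1, 1]].map
        (coloringOfList cubeIndex)) (by decide +kernel))
    (by decide +kernel)

/-! ### The octahedron -/

/-- This is `x(x - 4)(x + 2)`. -/
def octahedronCoefficients : List (ℕ × ℕ) :=
  [(0, 0), (0, 8), (0, 2), (1, 0)]

def octahedronIntersection : Matrix (Fin 3) (Fin 3) ℕ :=
  !![0, 4, 0; 1, 2, 1; 0, 4, 0]

theorem octahedron_isDistancePartition :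
    IsDistancePartition octahedronGraph octahedronDistance octahedronIntersection :=
  ⟨by decide +kernel, by decide +kernel⟩

theorem octahedron_connected : octahedronGraph.Connected :=
  octahedron_isDistancePartition.connected fun i => by fin_cases i <;> decide

theorem octahedron_degree (v : _) : octahedronGraph.degree v = 4 := by
  revert v
  decide +kernel

theorem octahedron_aeval_eq_zero :
    aeval (octahedronGraph.adjMatrix ℤ) (differencePolynomial octahedronCoefficients) = 0 := by
  apply octahedron_isDistancePartition.aeval_adjMatrix_eq_zero
  rw [aeval_differencePolynomial]
  decide +kernel

/-- Both classes would have three vertices and induce a 1-regular graph, against the parity of the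
degree sum. The code simply tries all colorings. -/
theorem octahedron_not_mem :
    !![1, 3; 3, 1] ∉ colorAdjacencyMatrices octahedronGraph 2 := by
  rintro ⟨f, hf⟩
  revert f
  decide +kernel

theorem octahedron_charpoly_dvd :
    ((!![1, 3; 3, 1] : Matrix (Fin 2) (Fin 2) ℕ).map (fun a : ℕ => (a : ℂ))).charpoly ∣
      (octahedronGraph.adjMatrix ℂ).charpoly := by
  refine Matrix.charpoly_dvd_charpoly_of_intertwine
    -- A fractional coloring: one axis in each color, and the third axis half of each. It
    -- intertwines just as a coloring does, and `Q` reads off one vertex on each of the first two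
    -- axes.
    (P := Matrix.of fun v => (![![1, 0], ![0, 1], ![1 / 2, 1 / 2]] : Fin 3 → Fin 2 → ℂ) v.1)
    (Q := Matrix.of fun j v => if v = (j.castSucc, true) then 1 else 0) ?_ ?_
  · ext i j
    fin_cases i <;> fin_cases j <;> simp [Matrix.mul_apply]
  · have hadj : ∀ x y, octahedronGraph.Adj x y ↔ x.1 ≠ y.1 := fun _ _ => Iff.rfl
    ext ⟨i, b⟩ j
    fin_cases i <;> fin_cases j <;>
      simp [Matrix.mul_apply, SimpleGraph.adjMatrix_apply, hadj, Fintype.sum_prod_type,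
        Fin.sum_univ_succ] <;> norm_num

theorem octahedron_two_complete (A : Matrix (Fin 2) (Fin 2) ℕ) (hA : IsCandidate octahedronGraph A) :
    ∃ B ∈ [!![0, 4; 2, 2], !![1, 3; 3, 1], !![2, 2; 2, 2]], ColorEquivalent A B :=
  exists_colorEquivalent_of_holdsForSorted (n := 6) rfl octahedron_degree octahedron_aeval_eq_zero
    (holdsForSorted_of_searchTwo (by decide +kernel)) A hA

theorem octahedron_two_realized : ∀ B ∈ [!![0, 4; 2, 2], !![2, 2; 2, 2]],
    B ∈ colorAdjacencyMatrices octahedronGraph 2 :=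
  mem_colorAdjacencyMatrices_of_forall₂ (fs :=
    [[0, 0, 1, 1, 1, 1],
        [0, 1, 0, 1, 0, 1]].map
        (coloringOfList octahedronIndex)) (by decide +kernel)

theorem octahedron_two_candidates :
    ListsCandidates octahedronGraph (m := 2)
      [!![0, 4; 2, 2], !![1, 3; 3, 1], !![2, 2; 2, 2]] := by
  refine listsCandidates_of octahedron_two_complete (fun B hB => ?_) (by decide +kernel)
  have hreal : B ∈ colorAdjacencyMatrices octahedronGraph 2 → IsCandidate octahedronGraph B ∧
      (B.map (fun a : ℕ => (a : ℂ))).charpoly ∣ (octahedronGraph.adjMatrix ℂ).charpoly :=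
    fun ⟨f, hf⟩ => ⟨hf.isCandidate octahedron_degree octahedron_connected, hf.charpoly_dvd⟩
  simp only [List.mem_cons, List.not_mem_nil, or_false] at hB
  rcases hB with rfl | rfl | rfl
  · exact hreal (octahedron_two_realized _ (by simp))
  · refine ⟨isCandidate_of_charpoly_dvd octahedron_degree (by decide) ?_
      ⟨![3, 3], by decide, by decide, by decide⟩ octahedron_charpoly_dvd, octahedron_charpoly_dvd⟩
    rintro ⟨S, ⟨i, hi⟩, ⟨j, hj⟩, hS⟩
    have : ∀ i j, (!![1, 3; 3, 1] : Matrix (Fin 2) (Fin 2) ℕ) i j ≠ 0 := by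
      intro i j
      fin_cases i <;> fin_cases j <;> simp
    exact this i j (hS i hi j hj).1
  · exact hreal (octahedron_two_realized _ (by simp))

theorem octahedron_two_colors :
    ListsUpToColors (m := 2)
      [!![0, 4; 2, 2], !![2, 2; 2, 2]] (colorAdjacencyMatrices octahedronGraph 2) := by
  refine listsUpToColors_colorAdjacencyMatrices (fun A hA => ?_) octahedron_two_realized
    (by decide +kernel)
  obtain ⟨f, hf⟩ := hA
  obtain ⟨B, hB, hAB⟩ :=
    octahedron_two_complete A (hf.isCandidate octahedron_degree octahedron_connected)
  simp only [List.mem_cons, List.not_mem_nil, or_false] at hB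
  rcases hB with rfl | rfl | rfl
  · exact ⟨_, by simp, hAB⟩
  · exact absurd (colorAdjacencyMatrices_of_colorEquivalent ⟨f, hf⟩ hAB.symm) octahedron_not_mem
  · exact ⟨_, by simp, hAB⟩

theorem octahedron_three_colors :
    ListsCandidatesAllRealized octahedronGraph (m := 3)
      [!![0, 0, 4; 0, 0, 4; 1, 1, 2], !![0, 2, 2; 2, 0, 2; 2, 2, 0], !![0, 2, 2; 2, 1, 1; 2, 1,
        1]] := by
  refine listsCandidatesAllRealized_of octahedron_degree octahedron_connected
    (exists_colorEquivalent_of_holdsForSorted (n := 6) rfl octahedron_degree octahedron_aeval_eq_zero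
      (holdsForSorted_of_searchThree (by decide +kernel)))
    (mem_colorAdjacencyMatrices_of_forall₂ (fs :=
      [[0, 1, 2, 2, 2, 2],
        [0, 0, 1, 1, 2, 2],
        [0, 0, 1, 2, 1, 2]].map
        (coloringOfList octahedronIndex)) (by decide +kernel))
    (by decide +kernel)

theorem octahedron_four_colors :
    ListsCandidatesAllRealized octahedronGraph (m := 4)
      [!![0, 0, 2, 2; 0, 0, 2, 2; 1, 1, 0, 2; 1, 1, 2, 0], !![0, 0, 2, 2; 0, 0, 2, 2; 1, 1, 1, 1;
        1, 1, 1, 1]] := by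
  refine listsCandidatesAllRealized_of octahedron_degree octahedron_connected
    (exists_colorEquivalent_of_holdsForSorted (n := 6) rfl octahedron_degree octahedron_aeval_eq_zero
      (holdsForSorted_of_searchFour (by decide +kernel)))
    (mem_colorAdjacencyMatrices_of_forall₂ (fs :=
      [[0, 1, 2, 2, 3, 3],
        [0, 1, 2, 3, 2, 3]].map
        (coloringOfList octahedronIndex)) (by decide +kernel))
    (by decide +kernel)

/-! ### The dodecahedron -/

/-- This is `x(x - 3)(x - 1)(x + 2)(x ^ 2 - 5)`. -/
def dodecahedronCoefficients : List (ℕ × ℕ) :=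
  [(0, 0), (0, 30), (25, 0), (16, 0), (0, 10), (0, 2), (1, 0)]

def dodecahedronIntersection : Matrix (Fin 6) (Fin 6) ℕ :=
  !![0, 3, 0, 0, 0, 0; 1, 0, 2, 0, 0, 0; 0, 1, 1, 1, 0, 0; 0, 0, 1, 1, 1, 0; 0, 0, 0, 2, 0, 1; 0,
    0, 0, 0, 3, 0]

theorem dodecahedron_isDistancePartition :
    IsDistancePartition dodecahedronGraph dodecahedronDistance dodecahedronIntersection :=
  ⟨by decide +kernel, by decide +kernel⟩

theorem dodecahedron_connected : dodecahedronGraph.Connected :=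
  dodecahedron_isDistancePartition.connected fun i => by fin_cases i <;> decide

theorem dodecahedron_degree (v : _) : dodecahedronGraph.degree v = 3 := by
  revert v
  decide +kernel

theorem dodecahedron_aeval_eq_zero :
    aeval (dodecahedronGraph.adjMatrix ℤ) (differencePolynomial dodecahedronCoefficients) = 0 := by
  apply dodecahedron_isDistancePartition.aeval_adjMatrix_eq_zero
  rw [aeval_differencePolynomial]
  decide +kernel

theorem dodecahedron_two_colors :
    ListsCandidatesAllRealized dodecahedronGraph (m := 2)
      [!![0, 3; 2, 1], !![2, 1; 1, 2]] := by
  refine listsCandidatesAllRealized_of dodecahedron_degree dodecahedron_connected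
    (exists_colorEquivalent_of_holdsForSorted (n := 20) rfl dodecahedron_degree dodecahedron_aeval_eq_zero
      (holdsForSorted_of_searchTwo (by decide +kernel)))
    (mem_colorAdjacencyMatrices_of_forall₂ (fs :=
      [[0, 1, 0, 1, 1, 0, 1, 0, 1, 1, 1, 1, 1, 0, 0, 1, 1, 1, 0, 0],
        -- The two rings of the generalized Petersen graph, joined by the spokes.
        [0, 0, 0, 0, 0, 0, 0, 0, 0, 0, 1, 1, 1, 1, 1, 1, 1, 1, 1, 1]].map
        (coloringOfList dodecahedronIndex)) (by decide +kernel))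
    (by decide +kernel)

theorem dodecahedron_three_colors :
    ListsCandidatesAllRealized dodecahedronGraph (m := 3)
      [!![0, 0, 3; 0, 0, 3; 1, 1, 1], !![0, 3, 0; 1, 0, 2; 0, 1, 2], !![1, 0, 2; 0, 1, 2; 1, 2,
        0]] := by
  refine listsCandidatesAllRealized_of dodecahedron_degree dodecahedron_connected
    (exists_colorEquivalent_of_holdsForSorted (n := 20) rfl dodecahedron_degree dodecahedron_aeval_eq_zero
      (holdsForSorted_of_searchThree (by decide +kernel)))
    (mem_colorAdjacencyMatrices_of_forall₂ (fs :=
      [[0, 2, 1, 2, 2, 1, 2, 0, 2, 2, 2, 2, 2, 0, 0, 2, 2, 2, 1, 1],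
        [0, 1, 2, 2, 1, 0, 1, 2, 2, 1, 1, 2, 2, 2, 2, 1, 2, 2, 2, 2],
        [0, 0, 2, 1, 2, 0, 0, 2, 1, 2, 2, 2, 1, 1, 1, 2, 2, 1, 1, 1]].map
        (coloringOfList dodecahedronIndex)) (by decide +kernel))
    (by decide +kernel)

theorem dodecahedron_four_colors :
    ListsCandidatesAllRealized dodecahedronGraph (m := 4)
      [!![0, 0, 0, 3; 0, 0, 2, 1; 0, 2, 0, 1; 1, 1, 1, 0], !![0, 0, 0, 3; 0, 1, 1, 1; 0, 1, 1, 1;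
        1, 1, 1, 0], !![0, 0, 1, 2; 0, 0, 1, 2; 1, 1, 1, 0; 1, 1, 0, 1], !![0, 0, 1, 2; 0, 2, 0,
        1; 1, 0, 2, 0; 2, 1, 0, 0], !![1, 0, 0, 2; 0, 1, 0, 2; 0, 0, 1, 2; 1, 1, 1, 0]] := by
  refine listsCandidatesAllRealized_of dodecahedron_degree dodecahedron_connected
    (exists_colorEquivalent_of_holdsForSorted (n := 20) rfl dodecahedron_degree dodecahedron_aeval_eq_zero
      (holdsForSorted_of_searchFour (by decide +kernel)))
    (mem_colorAdjacencyMatrices_of_forall₂ (fs :=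
      [[0, 3, 1, 2, 3, 0, 3, 1, 2, 3, 3, 2, 2, 1, 1, 3, 2, 2, 1, 1],
        [0, 3, 1, 1, 3, 0, 3, 2, 2, 3, 3, 2, 2, 2, 2, 3, 1, 1, 1, 1],
        [0, 2, 1, 3, 3, 1, 2, 0, 3, 3, 3, 2, 3, 0, 0, 3, 2, 3, 1, 1],
        [0, 2, 2, 2, 0, 3, 1, 1, 1, 3, 3, 2, 0, 2, 3, 0, 1, 3, 1, 0],
        [0, 0, 3, 1, 3, 0, 0, 3, 1, 3, 3, 3, 2, 1, 2, 3, 3, 2, 1, 2]].map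
        (coloringOfList dodecahedronIndex)) (by decide +kernel))
    (by decide +kernel)

/-! ### The icosahedron -/

/-- This is `(x - 5)(x + 1)(x ^ 2 - 5)`. -/
def icosahedronCoefficients : List (ℕ × ℕ) :=
  [(25, 0), (20, 0), (0, 10), (0, 4), (1, 0)]

def icosahedronIntersection : Matrix (Fin 4) (Fin 4) ℕ :=
  !![0, 5, 0, 0; 1, 2, 2, 0; 0, 2, 2, 1; 0, 0, 5, 0]

theorem icosahedron_isDistancePartition :
    IsDistancePartition icosahedronGraph icosahedronDistance icosahedronIntersection :=
  ⟨by decide +kernel, by decide +kernel⟩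

theorem icosahedron_connected : icosahedronGraph.Connected :=
  icosahedron_isDistancePartition.connected fun i => by fin_cases i <;> decide

theorem icosahedron_degree (v : _) : icosahedronGraph.degree v = 5 := by
  revert v
  decide +kernel

theorem icosahedron_aeval_eq_zero :
    aeval (icosahedronGraph.adjMatrix ℤ) (differencePolynomial icosahedronCoefficients) = 0 := by
  apply icosahedron_isDistancePartition.aeval_adjMatrix_eq_zero
  rw [aeval_differencePolynomial]
  decide +kernel

theorem icosahedron_two_colors :
    ListsCandidatesAllRealized icosahedronGraph (m := 2)
      [!![0, 5; 1, 4], !![1, 4; 2, 3], !![2, 3; 3, 2]] := by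
  refine listsCandidatesAllRealized_of icosahedron_degree icosahedron_connected
    (exists_colorEquivalent_of_holdsForSorted (n := 12) rfl icosahedron_degree icosahedron_aeval_eq_zero
      (holdsForSorted_of_searchTwo (by decide +kernel)))
    (mem_colorAdjacencyMatrices_of_forall₂ (fs :=
      [[0, 1, 1, 1, 1, 1, 0, 1, 1, 1, 1, 1],
        [0, 0, 1, 1, 1, 1, 0, 1, 1, 1, 0, 1],
        [0, 0, 0, 1, 1, 1, 0, 1, 1, 1, 0, 0]].map
        (coloringOfList icosahedronIndex)) (by decide +kernel))
    (by decide +kernel)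

theorem icosahedron_three_colors :
    ListsCandidatesAllRealized icosahedronGraph (m := 3)
      [!![0, 1, 4; 1, 0, 4; 1, 1, 3], !![0, 2, 3; 1, 1, 3; 1, 2, 2], !![1, 2, 2; 2, 1, 2; 2, 2,
        1]] := by
  refine listsCandidatesAllRealized_of icosahedron_degree icosahedron_connected
    (exists_colorEquivalent_of_holdsForSorted (n := 12) rfl icosahedron_degree icosahedron_aeval_eq_zero
      (holdsForSorted_of_searchThree (by decide +kernel)))
    (mem_colorAdjacencyMatrices_of_forall₂ (fs :=
      [[0, 1, 2, 2, 2, 2, 0, 2, 2, 2, 1, 2],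
        [0, 1, 1, 2, 2, 2, 0, 2, 2, 2, 1, 1],
        [0, 0, 1, 1, 2, 2, 0, 1, 2, 2, 0, 1]].map
        (coloringOfList icosahedronIndex)) (by decide +kernel))
    (by decide +kernel)

theorem icosahedron_four_colors :
    ListsCandidatesAllRealized icosahedronGraph (m := 4)
      [!![0, 0, 0, 5; 0, 0, 5, 0; 0, 1, 2, 2; 1, 0, 2, 2], !![0, 1, 1, 3; 1, 0, 1, 3; 1, 1, 0, 3;
        1, 1, 1, 2], !![0, 1, 2, 2; 1, 0, 2, 2; 1, 1, 1, 2; 1, 1, 2, 1], !![0, 1, 2, 2; 1, 2, 0,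
        2; 2, 0, 2, 1; 2, 2, 1, 0]] := by
  refine listsCandidatesAllRealized_of icosahedron_degree icosahedron_connected
    (exists_colorEquivalent_of_holdsForSorted (n := 12) rfl icosahedron_degree icosahedron_aeval_eq_zero
      (holdsForSorted_of_searchFour (by decide +kernel)))
    (mem_colorAdjacencyMatrices_of_forall₂ (fs :=
      [[0, 3, 3, 3, 3, 3, 1, 2, 2, 2, 2, 2],
        [0, 1, 2, 3, 3, 3, 0, 3, 3, 3, 1, 2],
        [0, 1, 2, 2, 3, 3, 0, 2, 3, 3, 1, 2],
        [0, 1, 3, 2, 2, 3, 3, 1, 1, 0, 2, 0]].map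
        (coloringOfList icosahedronIndex)) (by decide +kernel))
    (by decide +kernel)

theorem mainTheorem4 :
    -- two colors
    ListsCandidatesAllRealized tetrahedronGraph (m := 2)
      [!![0, 3; 1, 2], !![1, 2; 2, 1]] ∧
    ListsCandidatesAllRealized cubeGraph (m := 2)
      [!![0, 3; 1, 2], !![0, 3; 3, 0], !![1, 2; 2, 1], !![2, 1; 1, 2]] ∧
    (ListsCandidates octahedronGraph (m := 2)
        [!![0, 4; 2, 2], !![1, 3; 3, 1], !![2, 2; 2, 2]] ∧
      ListsUpToColors (m := 2)
        [!![0, 4; 2, 2], !![2, 2; 2, 2]] (colorAdjacencyMatrices octahedronGraph 2) ∧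
      !![1, 3; 3, 1] ∉ colorAdjacencyMatrices octahedronGraph 2) ∧
    ListsCandidatesAllRealized dodecahedronGraph (m := 2)
      [!![0, 3; 2, 1], !![2, 1; 1, 2]] ∧
    ListsCandidatesAllRealized icosahedronGraph (m := 2)
      [!![0, 5; 1, 4], !![1, 4; 2, 3], !![2, 3; 3, 2]] ∧
    -- three colors
    ListsCandidatesAllRealized tetrahedronGraph (m := 3)
      [!![0, 1, 2; 1, 0, 2; 1, 1, 1]] ∧
    ListsCandidatesAllRealized cubeGraph (m := 3)
      [!![0, 1, 2; 1, 0, 2; 1, 1, 1], !![1, 0, 2; 0, 1, 2; 1, 1, 1]] ∧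
    ListsCandidatesAllRealized octahedronGraph (m := 3)
      [!![0, 0, 4; 0, 0, 4; 1, 1, 2], !![0, 2, 2; 2, 0, 2; 2, 2, 0],
        !![0, 2, 2; 2, 1, 1; 2, 1, 1]] ∧
    ListsCandidatesAllRealized dodecahedronGraph (m := 3)
      [!![0, 0, 3; 0, 0, 3; 1, 1, 1], !![0, 3, 0; 1, 0, 2; 0, 1, 2],
        !![1, 0, 2; 0, 1, 2; 1, 2, 0]] ∧
    ListsCandidatesAllRealized icosahedronGraph (m := 3)
      [!![0, 1, 4; 1, 0, 4; 1, 1, 3], !![0, 2, 3; 1, 1, 3; 1, 2, 2],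
        !![1, 2, 2; 2, 1, 2; 2, 2, 1]] ∧
    -- four colors
    ListsCandidatesAllRealized tetrahedronGraph (m := 4)
      [!![0, 1, 1, 1; 1, 0, 1, 1; 1, 1, 0, 1; 1, 1, 1, 0]] ∧
    ListsCandidatesAllRealized cubeGraph (m := 4)
      [!![0, 0, 0, 3; 0, 0, 3, 0; 0, 1, 0, 2; 1, 0, 2, 0],
        !![0, 0, 1, 2; 0, 0, 2, 1; 1, 2, 0, 0; 2, 1, 0, 0],
        !![0, 1, 1, 1; 1, 0, 1, 1; 1, 1, 0, 1; 1, 1, 1, 0],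
        !![0, 1, 1, 1; 1, 0, 1, 1; 1, 1, 1, 0; 1, 1, 0, 1],
        !![1, 0, 1, 1; 0, 1, 1, 1; 1, 1, 1, 0; 1, 1, 0, 1]] ∧
    ListsCandidatesAllRealized octahedronGraph (m := 4)
      [!![0, 0, 2, 2; 0, 0, 2, 2; 1, 1, 0, 2; 1, 1, 2, 0],
        !![0, 0, 2, 2; 0, 0, 2, 2; 1, 1, 1, 1; 1, 1, 1, 1]] ∧
    ListsCandidatesAllRealized dodecahedronGraph (m := 4)
      [!![0, 0, 0, 3; 0, 0, 2, 1; 0, 2, 0, 1; 1, 1, 1, 0],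
        !![0, 0, 0, 3; 0, 1, 1, 1; 0, 1, 1, 1; 1, 1, 1, 0],
        !![0, 0, 1, 2; 0, 0, 1, 2; 1, 1, 1, 0; 1, 1, 0, 1],
        !![0, 0, 1, 2; 0, 2, 0, 1; 1, 0, 2, 0; 2, 1, 0, 0],
        !![1, 0, 0, 2; 0, 1, 0, 2; 0, 0, 1, 2; 1, 1, 1, 0]] ∧
    ListsCandidatesAllRealized icosahedronGraph (m := 4)
      [!![0, 0, 0, 5; 0, 0, 5, 0; 0, 1, 2, 2; 1, 0, 2, 2],
        !![0, 1, 1, 3; 1, 0, 1, 3; 1, 1, 0, 3; 1, 1, 1, 2],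
        !![0, 1, 2, 2; 1, 0, 2, 2; 1, 1, 1, 2; 1, 1, 2, 1],
        !![0, 1, 2, 2; 1, 2, 0, 2; 2, 0, 2, 1; 2, 2, 1, 0]] := 
  ⟨tetrahedron_two_colors,
    cube_two_colors,
    ⟨octahedron_two_candidates, octahedron_two_colors, octahedron_not_mem⟩,
    dodecahedron_two_colors,
    icosahedron_two_colors,
    tetrahedron_three_colors,
    cube_three_colors,
    octahedron_three_colors,
    dodecahedron_three_colors,
    icosahedron_three_colors,
    tetrahedron_four_colors,
    cube_four_colors,
    octahedron_four_colors,
    dodecahedron_four_colors,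
    icosahedron_four_colors⟩
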